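/- All algebras are complex and need not have a unit; $\odot$ is the algebraic tensor product over $\mathbb C$ and $A'$ is the algebraic dual of $A$. An algebra $A$ is non-degenerate if $ab=0$ for all $b\in A$ implies $a=0$, and $ba=0$ for all $b\in A$ implies $a=0$; $M(A)$ is then its multiplier algebra. A homomorphism $\pi:A\to M(B)$ is non-degenerate if the linear spans $\pi(A)B$ and $B\,\pi(A)$ are both equal to $B$. Let $(A,\Delta)$ be an algebraic quantum group with left Haar functional $\varphi$. That is, $A$ is a non-degenerate algebra and $\Delta:A\to M(A\odot A)$ is a non-degenerate homomorphism with $(\Delta\odot\iota)\Delta=(\iota\odot\Delta)\Delta$, such that the maps sending $a\otimes b$ to $\Delta(a)(b\otimes 1)$, $\Delta(a)(1\otimes b)$, $(b\otimes 1)\Delta(a)$ and $(1\otimes b)\Delta(a)$ are bijections from $A\odot A$ onto $A\odot A$; and $\varphi$ is a non-zero linear functional on $A$ with $(\iota\odot\varphi)\Delta(a)=\varphi(a)1$ for all $a\in A$. For $a\in A$ and $\omega\in A'$ put $(a\omega)(x)=\omega(xa)$. The dual is the algebra $\hat A=\{a\varphi\mid a\in A\}\subseteq A'$ with product $(\omega_1\omega_2)(x)=\omega_1\big((\iota\odot\omega_2)\Delta(x)\big)$.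 There is a unique $U\in M(A\odot\hat A)$ (the universal corepresentation) such that, with $A\odot\hat A$ regarded as a space of linear operators on $A$ through $(a\otimes\omega)(y)=\omega(y)a$, $$[U(x\otimes\omega)](y)=(\iota\odot\omega)(\Delta(y)(x\otimes1)),\qquad [(x\otimes\omega)U](y)=(\omega\odot\iota)((1\otimes x)\Delta(y))\qquad(x,y\in A,\ \omega\in\hat A).$$ **Proposition.** Let $B$ be a non-degenerate algebra and let $V$ be a corepresentation of $(A,\Delta)$ on $B$, that is, an element $V\in M(A\odot B)$ with $(\Delta\odot\iota)(V)=V_{13}V_{23}$. There is a unique homomorphism $\pi_V:\hat A\to M(B)$ with $\pi_V(\omega)=(\omega\odot\iota)(V)$ for all $\omega\in\hat A$, where $(\omega\odot\iota)(V)$ is determined by $(a\theta\odot\iota)(V)\,x=(\theta\odot\iota)(V(a\otimes x))$ for $a\in A$, $\theta\in A'$, $x\in B$. The following are equivalent: 1. $V$ is non-degenerate, i.e. invertible in $M(A\odot B)$; 2. $\pi_V$ is non-degenerate; 3. $V(A\odot B)=(A\odot B)V=A\odot B$. In that case $(\iota\odot\pi_V)(U)=V$, where $\iota\odot\pi_V:M(A\odot\hat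 A)\to M(A\odot B)$ is the canonical extension of the homomorphism $a\otimes\omega\mapsto a\otimes\pi_V(\omega)$. -/

import Mathlib

set_option linter.unusedSectionVars false
set_option linter.unusedSimpArgs false

open scoped TensorProduct

namespace AlgQG

/-- A (not necessarily unital) algebra is non-degenerate if `a b = 0` for all `b` forces
`a = 0`, and `b a = 0` for all `b` forces `a = 0`. -/
class IsNondegenerate (A : Type*) [NonUnitalRing A] : Prop where
  eq_zero_of_mul_right : ∀ a : A, (∀ b : A, a * b = 0) → a = 0
  eq_zero_of_mul_left : ∀ a : A, (∀ b : A, b * a = 0) → a = 0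

section Multiplier

variable (A : Type*) [NonUnitalRing A] [Module ℂ A] [IsScalarTower ℂ A A] [SMulCommClass ℂ A A]

/-- The multiplier algebra `M(A)`: pairs `(L, R)` of linear maps on `A` (to be read as
`L a = m a`, `R a = a m`) with `L (a b) = L a · b`, `R (a b) = a · R b` and `a · L b = R a · b`.
The second component is taken in the opposite algebra since `a (m n) = (a m) n`. -/
def multiplierAlgebra : Subalgebra ℂ (Module.End ℂ A × (Module.End ℂ A)ᵐᵒᵖ) where
  carrier := {m | (∀ a b, m.1 (a * b) = m.1 a * b) ∧
    (∀ a b, m.2.unop (a * b) = a * m.2.unop b) ∧ ∀ a b, a * m.1 b = m.2.unop a * b}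
  mul_mem' := by
    rintro m n ⟨h1, h2, h3⟩ ⟨k1, k2, k3⟩
    refine ⟨fun a b => ?_, fun a b => ?_, fun a b => ?_⟩
    · simp [h1, k1]
    · simp [h2, k2]
    · simp [h3, k3]
  add_mem' := by
    rintro m n ⟨h1, h2, h3⟩ ⟨k1, k2, k3⟩
    refine ⟨fun a b => ?_, fun a b => ?_, fun a b => ?_⟩
    · simp [h1, k1, add_mul]
    · simp [h2, k2, mul_add]
    · simp [h3, k3, mul_add, add_mul]
  algebraMap_mem' := by
    intro r
    refine ⟨fun a b => ?_, fun a b => ?_, fun a b => ?_⟩ <;>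
      simp [Module.algebraMap_end_apply, smul_mul_assoc, mul_smul_comm]

/-- The multiplier algebra `M(A)`, as a type. -/
abbrev Multiplier : Type _ := ↥(multiplierAlgebra A)

variable {A}

namespace Multiplier

/-- Left multiplication `a ↦ m a` by a multiplier. -/
def left (m : Multiplier A) : A →ₗ[ℂ] A := m.1.1

/-- Right multiplication `a ↦ a m` by a multiplier. -/
def right (m : Multiplier A) : A →ₗ[ℂ] A := m.1.2.unop

theorem left_apply_mul (m : Multiplier A) (a b : A) : left m (a * b) = left m a * b :=
  m.2.1 a b

theorem right_apply_mul (m : Multiplier A) (a b : A) : right m (a * b) = a * right m b :=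
  m.2.2.1 a b

theorem mul_left_eq (m : Multiplier A) (a b : A) : a * left m b = right m a * b :=
  m.2.2.2 a b

theorem ext {m n : Multiplier A} (h : left m = left n) (h' : right m = right n) : m = n :=
  Subtype.ext (Prod.ext h (MulOpposite.unop_injective h'))

/-- The multiplier with given left and right multiplications. -/
def mk (L R : A →ₗ[ℂ] A) (hL : ∀ a b, L (a * b) = L a * b) (hR : ∀ a b, R (a * b) = a * R b)
    (hLR : ∀ a b, a * L b = R a * b) : Multiplier A :=
  ⟨(L, MulOpposite.op R), hL, hR, hLR⟩

section mk
variable (L R : A →ₗ[ℂ] A) (hL : ∀ a b, L (a * b) = L a * b) (hR : ∀ a b, R (a * b) = a * R b)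
    (hLR : ∀ a b, a * L b = R a * b)
@[simp] theorem left_mk : left (mk L R hL hR hLR) = L := rfl
@[simp] theorem right_mk : right (mk L R hL hR hLR) = R := rfl
end mk

@[simp] theorem left_one (a : A) : left (1 : Multiplier A) a = a := rfl
@[simp] theorem right_one (a : A) : right (1 : Multiplier A) a = a := rfl
@[simp] theorem left_mul (m n : Multiplier A) (a : A) :
    left (m * n) a = left m (left n a) := rfl
@[simp] theorem right_mul (m n : Multiplier A) (a : A) :
    right (m * n) a = right n (right m a) := rfl
@[simp] theorem left_zero (a : A) : left (0 : Multiplier A) a = 0 := rfl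
@[simp] theorem right_zero (a : A) : right (0 : Multiplier A) a = 0 := rfl
@[simp] theorem left_add (m n : Multiplier A) (a : A) :
    left (m + n) a = left m a + left n a := rfl
@[simp] theorem right_add (m n : Multiplier A) (a : A) :
    right (m + n) a = right m a + right n a := rfl
@[simp] theorem left_smul (c : ℂ) (m : Multiplier A) (a : A) :
    left (c • m) a = c • left m a := rfl
@[simp] theorem right_smul (c : ℂ) (m : Multiplier A) (a : A) :
    right (c • m) a = c • right m a := rfl

/-- The linear map `m ↦ (a ↦ m a)`. -/
def leftHom : Multiplier A →ₗ[ℂ] A →ₗ[ℂ] A where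
  toFun := left
  map_add' _ _ := rfl
  map_smul' _ _ := rfl

/-- The linear map `m ↦ (a ↦ a m)`. -/
def rightHom : Multiplier A →ₗ[ℂ] A →ₗ[ℂ] A where
  toFun := right
  map_add' _ _ := rfl
  map_smul' _ _ := rfl

@[simp] theorem leftHom_apply (m : Multiplier A) : leftHom m = left m := rfl
@[simp] theorem rightHom_apply (m : Multiplier A) : rightHom m = right m := rfl

/-- The canonical embedding `A → M(A)`. -/
def incl (a : A) : Multiplier A :=
  mk (LinearMap.mulLeft ℂ a) (LinearMap.mulRight ℂ a)
    (by simp [mul_assoc]) (by simp [mul_assoc]) (by simp [mul_assoc])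

@[simp] theorem left_incl (a x : A) : left (incl a) x = a * x := rfl
@[simp] theorem right_incl (a x : A) : right (incl a) x = x * a := rfl

theorem incl_left (m : Multiplier A) (a : A) : incl (left m a) = m * incl a :=
  ext (by ext x; simp [left_apply_mul]) (by ext x; simp [mul_left_eq])

theorem incl_right (m : Multiplier A) (a : A) : incl (right m a) = incl a * m :=
  ext (by ext x; simp [mul_left_eq]) (by ext x; simp [right_apply_mul])

theorem incl_injective [IsNondegenerate A] : Function.Injective (incl (A := A)) := by
  intro a b h
  rw [← sub_eq_zero]
  refine IsNondegenerate.eq_zero_of_mul_right _ fun x => ?_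
  have := congrArg (fun m => left m x) h
  simpa [sub_mul, sub_eq_zero] using this

variable {B : Type*} [NonUnitalRing B] [Module ℂ B] [IsScalarTower ℂ B B] [SMulCommClass ℂ B B]

/-- Transport of multipliers along an isomorphism of algebras. -/
def transport (e : A ≃ₗ[ℂ] B) (he : ∀ x y, e (x * y) = e x * e y) (m : Multiplier A) :
    Multiplier B :=
  have he' : ∀ x y, e.symm (x * y) = e.symm x * e.symm y := fun x y =>
    e.injective (by simp [he])
  mk (e.toLinearMap ∘ₗ left m ∘ₗ e.symm.toLinearMap) (e.toLinearMap ∘ₗ right m ∘ₗ e.symm.toLinearMap)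
    (by simp [he, he', left_apply_mul]) (by simp [he, he', right_apply_mul])
    (fun a b => e.symm.injective (by simp [he', mul_left_eq]))

section transport
variable (e : A ≃ₗ[ℂ] B) (he : ∀ x y, e (x * y) = e x * e y) (m : Multiplier A) (x : B)
@[simp] theorem left_transport : left (transport e he m) x = e (left m (e.symm x)) := rfl
@[simp] theorem right_transport : right (transport e he m) x = e (right m (e.symm x)) := rfl
end transport

theorem tensor_aux {f g : A ⊗[ℂ] B →ₗ[ℂ] A ⊗[ℂ] B →ₗ[ℂ] A ⊗[ℂ] B}
    (h : ∀ a b a' b', f (a ⊗ₜ b) (a' ⊗ₜ b') = g (a ⊗ₜ b) (a' ⊗ₜ b')) (x y : A ⊗[ℂ] B) :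
    f x y = g x y := by
  suffices f = g by rw [this]
  ext a b a' b'
  exact h a b a' b'

/-- The multiplier `m ⊗ n` of `A ⊗ B`, for `m ∈ M(A)` and `n ∈ M(B)`. -/
def tensor (m : Multiplier A) (n : Multiplier B) : Multiplier (A ⊗[ℂ] B) :=
  mk (TensorProduct.map (left m) (left n)) (TensorProduct.map (right m) (right n))
    (fun x y => tensor_aux
      (f := (LinearMap.mul ℂ (A ⊗[ℂ] B)).compr₂ (TensorProduct.map (left m) (left n)))
      (g := (LinearMap.mul ℂ (A ⊗[ℂ] B)) ∘ₗ (TensorProduct.map (left m) (left n)))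
      (by simp [left_apply_mul]) x y)
    (fun x y => tensor_aux
      (f := (LinearMap.mul ℂ (A ⊗[ℂ] B)).compr₂ (TensorProduct.map (right m) (right n)))
      (g := (LinearMap.mul ℂ (A ⊗[ℂ] B)).compl₂ (TensorProduct.map (right m) (right n)))
      (by simp [right_apply_mul]) x y)
    (fun x y => tensor_aux
      (f := (LinearMap.mul ℂ (A ⊗[ℂ] B)).compl₂ (TensorProduct.map (left m) (left n)))
      (g := (LinearMap.mul ℂ (A ⊗[ℂ] B)) ∘ₗ (TensorProduct.map (right m) (right n)))
      (by simp [mul_left_eq]) x y)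

@[simp] theorem left_tensor (m : Multiplier A) (n : Multiplier B) (x : A ⊗[ℂ] B) :
    left (tensor m n) x = TensorProduct.map (left m) (left n) x := rfl
@[simp] theorem right_tensor (m : Multiplier A) (n : Multiplier B) (x : A ⊗[ℂ] B) :
    right (tensor m n) x = TensorProduct.map (right m) (right n) x := rfl

end Multiplier

end Multiplier

section Slices

variable {A B C : Type*} [NonUnitalRing A] [Module ℂ A] [IsScalarTower ℂ A A] [SMulCommClass ℂ A A]
  [NonUnitalRing B] [Module ℂ B] [IsScalarTower ℂ B B] [SMulCommClass ℂ B B]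
  [NonUnitalRing C] [Module ℂ C] [IsScalarTower ℂ C C] [SMulCommClass ℂ C C]

/-- The slice map `ω ⊙ ι : A ⊗ B → B`. -/
def sliceFst {V W : Type*} [AddCommGroup V] [Module ℂ V] [AddCommGroup W] [Module ℂ W]
    (ω : Module.Dual ℂ V) : V ⊗[ℂ] W →ₗ[ℂ] W :=
  (TensorProduct.lid ℂ W).toLinearMap ∘ₗ LinearMap.rTensor W ω

/-- The slice map `ι ⊙ ω : A ⊗ B → A`. -/
def sliceSnd {V W : Type*} [AddCommGroup V] [Module ℂ V] [AddCommGroup W] [Module ℂ W]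
    (ω : Module.Dual ℂ W) : V ⊗[ℂ] W →ₗ[ℂ] V :=
  (TensorProduct.rid ℂ V).toLinearMap ∘ₗ LinearMap.lTensor V ω

section
variable {V W : Type*} [AddCommGroup V] [Module ℂ V] [AddCommGroup W] [Module ℂ W]

@[simp] theorem sliceFst_tmul (ω : Module.Dual ℂ V) (v : V) (w : W) :
    sliceFst ω (v ⊗ₜ[ℂ] w) = ω v • w := by simp [sliceFst]

@[simp] theorem sliceSnd_tmul (ω : Module.Dual ℂ W) (v : V) (w : W) :
    sliceSnd ω (v ⊗ₜ[ℂ] w) = ω w • v := by simp [sliceSnd]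

theorem eq_zero_of_sliceFst (z : V ⊗[ℂ] W) (h : ∀ ω : Module.Dual ℂ V, sliceFst ω z = 0) :
    z = 0 := by
  classical
  let b := Module.Basis.ofVectorSpace ℂ V
  apply (TensorProduct.equivFinsuppOfBasisLeft (N := W) b).injective
  rw [map_zero]
  ext i
  have key : ∀ y : V ⊗[ℂ] W,
      (TensorProduct.equivFinsuppOfBasisLeft (N := W) b) y i = sliceFst (b.coord i) y := by
    intro y
    induction y with
    | zero => simp
    | tmul v w => simp [TensorProduct.equivFinsuppOfBasisLeft_apply_tmul_apply]
    | add x y hx hy => simp [hx, hy]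
  rw [key, h]
  rfl

theorem eq_zero_of_sliceSnd (z : V ⊗[ℂ] W) (h : ∀ ω : Module.Dual ℂ W, sliceSnd ω z = 0) :
    z = 0 := by
  apply (TensorProduct.comm ℂ V W).injective
  rw [map_zero]
  apply eq_zero_of_sliceFst
  intro ω
  rw [← h ω]
  have key : ∀ y : V ⊗[ℂ] W, sliceFst ω (TensorProduct.comm ℂ V W y) = sliceSnd ω y := by
    intro y
    induction y with
    | zero => simp
    | tmul v w => simp
    | add x y hx hy => simp [hx, hy]
  exact key z

end

/-- The tensor product of non-degenerate algebras is non-degenerate. -/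
instance tensorNondegenerate [IsNondegenerate A] [IsNondegenerate B] :
    IsNondegenerate (A ⊗[ℂ] B) where
  eq_zero_of_mul_right z h := by
    have h1 : ∀ c : A, TensorProduct.map (LinearMap.mulRight ℂ c) LinearMap.id z = 0 := by
      intro c
      refine eq_zero_of_sliceFst _ fun ω => IsNondegenerate.eq_zero_of_mul_right _ fun d => ?_
      have : ∀ y : A ⊗[ℂ] B, sliceFst ω (TensorProduct.map (LinearMap.mulRight ℂ c)
          LinearMap.id y) * d = sliceFst ω (y * c ⊗ₜ[ℂ] d) := by
        intro y
        induction y with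
        | zero => simp
        | tmul v w => simp [smul_mul_assoc]
        | add x y hx hy => simp [add_mul, hx, hy]
      rw [this, h, map_zero]
    refine eq_zero_of_sliceSnd _ fun ω => IsNondegenerate.eq_zero_of_mul_right _ fun c => ?_
    have : ∀ y : A ⊗[ℂ] B, sliceSnd ω y * c =
        sliceSnd ω (TensorProduct.map (LinearMap.mulRight ℂ c) LinearMap.id y) := by
      intro y
      induction y with
      | zero => simp
      | tmul v w => simp [smul_mul_assoc]
      | add x y hx hy => simp [add_mul, hx, hy]
    rw [this, h1, map_zero]
  eq_zero_of_mul_left z h := by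
    have h1 : ∀ c : A, TensorProduct.map (LinearMap.mulLeft ℂ c) LinearMap.id z = 0 := by
      intro c
      refine eq_zero_of_sliceFst _ fun ω => IsNondegenerate.eq_zero_of_mul_left _ fun d => ?_
      have : ∀ y : A ⊗[ℂ] B, d * sliceFst ω (TensorProduct.map (LinearMap.mulLeft ℂ c)
          LinearMap.id y) = sliceFst ω (c ⊗ₜ[ℂ] d * y) := by
        intro y
        induction y with
        | zero => simp
        | tmul v w => simp [mul_smul_comm]
        | add x y hx hy => simp [mul_add, hx, hy]
      rw [this, h, map_zero]
    refine eq_zero_of_sliceSnd _ fun ω => IsNondegenerate.eq_zero_of_mul_left _ fun c => ?_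
    have : ∀ y : A ⊗[ℂ] B, c * sliceSnd ω y =
        sliceSnd ω (TensorProduct.map (LinearMap.mulLeft ℂ c) LinearMap.id y) := by
      intro y
      induction y with
      | zero => simp
      | tmul v w => simp [mul_smul_comm]
      | add x y hx hy => simp [mul_add, hx, hy]
    rw [this, h1, map_zero]

end Slices

section Extension

variable {A B C : Type*} [NonUnitalRing A] [Module ℂ A] [IsScalarTower ℂ A A] [SMulCommClass ℂ A A]
  [NonUnitalRing B] [Module ℂ B] [IsScalarTower ℂ B B] [SMulCommClass ℂ B B]
  [NonUnitalRing C] [Module ℂ C] [IsScalarTower ℂ C C] [SMulCommClass ℂ C C]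

open Multiplier

/-- A homomorphism `θ : A → M(C)` is non-degenerate if `θ(A) C = C = C θ(A)`, where `θ(A) C` and
`C θ(A)` denote the linear spans of the sets of products. -/
def IsNondegenerateHom (θ : A →ₙₐ[ℂ] Multiplier C) : Prop :=
  Submodule.span ℂ {x : C | ∃ (a : A) (c : C), x = left (θ a) c} = ⊤ ∧
  Submodule.span ℂ {x : C | ∃ (a : A) (c : C), x = right (θ a) c} = ⊤

/-- The map sending `a ⊗ b` to `c ↦ θ(a) c ⊗ b`, that is `x ↦ (c ↦ (θ ⊙ ι)(x) (c ⊗ 1))`. -/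
def homLeft (θ : A →ₙₐ[ℂ] Multiplier C) : A ⊗[ℂ] B →ₗ[ℂ] C →ₗ[ℂ] C ⊗[ℂ] B :=
  TensorProduct.lift (LinearMap.mk₂ ℂ
    (fun a b => (TensorProduct.mk ℂ C B).flip b ∘ₗ left (θ a))
    (fun a a' b => by ext; simp [TensorProduct.add_tmul])
    (fun r a b => by ext; simp [TensorProduct.smul_tmul'])
    (fun a b b' => by ext; simp [TensorProduct.tmul_add])
    (fun r a b => by ext; simp))

/-- The map sending `a ⊗ b` to `c ↦ c θ(a) ⊗ b`, that is `x ↦ (c ↦ (c ⊗ 1) (θ ⊙ ι)(x))`. -/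
def homRight (θ : A →ₙₐ[ℂ] Multiplier C) : A ⊗[ℂ] B →ₗ[ℂ] C →ₗ[ℂ] C ⊗[ℂ] B :=
  TensorProduct.lift (LinearMap.mk₂ ℂ
    (fun a b => (TensorProduct.mk ℂ C B).flip b ∘ₗ right (θ a))
    (fun a a' b => by ext; simp [TensorProduct.add_tmul])
    (fun r a b => by ext; simp [TensorProduct.smul_tmul'])
    (fun a b b' => by ext; simp [TensorProduct.tmul_add])
    (fun r a b => by ext; simp))

@[simp] theorem homLeft_tmul (θ : A →ₙₐ[ℂ] Multiplier C) (a : A) (b : B) (c : C) :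
    homLeft θ (a ⊗ₜ[ℂ] b) c = left (θ a) c ⊗ₜ[ℂ] b := rfl

@[simp] theorem homRight_tmul (θ : A →ₙₐ[ℂ] Multiplier C) (a : A) (b : B) (c : C) :
    homRight θ (a ⊗ₜ[ℂ] b) c = right (θ a) c ⊗ₜ[ℂ] b := rfl

theorem homRight_mul_homLeft (θ : A →ₙₐ[ℂ] Multiplier C) (x y : A ⊗[ℂ] B) (e c : C) :
    homRight θ y e * homLeft θ x c =
      TensorProduct.map (LinearMap.mulLeft ℂ e) LinearMap.id (homLeft θ (y * x) c) := by
  induction y with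
  | zero => simp
  | add y y' hy hy' => simp [add_mul, hy, hy']
  | tmul f b' =>
    induction x with
    | zero => simp
    | add x x' hx hx' => simp only [mul_add, map_add, LinearMap.add_apply, hx, hx']
    | tmul a b => simp [mul_left_eq]

/-- The map `a ⊗ c ⊗ b ↦ (θ ⊙ ι)(f (a ⊗ b)) (c ⊗ 1)`. -/
def preLeft (θ : A →ₙₐ[ℂ] Multiplier C) (f : A ⊗[ℂ] B →ₗ[ℂ] A ⊗[ℂ] B) :
    (A ⊗[ℂ] C) ⊗[ℂ] B →ₗ[ℂ] C ⊗[ℂ] B :=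
  TensorProduct.lift (homLeft θ ∘ₗ f) ∘ₗ (TensorProduct.rightComm ℂ A C B).toLinearMap

/-- The map `a ⊗ c ⊗ b ↦ (c ⊗ 1) (θ ⊙ ι)(f (a ⊗ b))`. -/
def preRight (θ : A →ₙₐ[ℂ] Multiplier C) (f : A ⊗[ℂ] B →ₗ[ℂ] A ⊗[ℂ] B) :
    (A ⊗[ℂ] C) ⊗[ℂ] B →ₗ[ℂ] C ⊗[ℂ] B :=
  TensorProduct.lift (homRight θ ∘ₗ f) ∘ₗ (TensorProduct.rightComm ℂ A C B).toLinearMap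

@[simp] theorem preLeft_tmul (θ : A →ₙₐ[ℂ] Multiplier C) (f : A ⊗[ℂ] B →ₗ[ℂ] A ⊗[ℂ] B)
    (a : A) (b : B) (c : C) :
    preLeft θ f (a ⊗ₜ c ⊗ₜ b) = homLeft θ (f (a ⊗ₜ b)) c := rfl

@[simp] theorem preRight_tmul (θ : A →ₙₐ[ℂ] Multiplier C) (f : A ⊗[ℂ] B →ₗ[ℂ] A ⊗[ℂ] B)
    (a : A) (b : B) (c : C) :
    preRight θ f (a ⊗ₜ c ⊗ₜ b) = homRight θ (f (a ⊗ₜ b)) c := rfl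

theorem preRight_mul_preLeft (θ : A →ₙₐ[ℂ] Multiplier C) (V : Multiplier (A ⊗[ℂ] B))
    (s t : (A ⊗[ℂ] C) ⊗[ℂ] B) :
    preRight θ LinearMap.id s * preLeft θ (left V) t =
      preRight θ (right V) s * preLeft θ LinearMap.id t := by
  suffices (LinearMap.mul ℂ (C ⊗[ℂ] B) ∘ₗ preRight θ LinearMap.id).compl₂ (preLeft θ (left V)) =
      (LinearMap.mul ℂ (C ⊗[ℂ] B) ∘ₗ preRight θ (right V)).compl₂ (preLeft θ LinearMap.id) from
    LinearMap.congr_fun₂ this s t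
  ext f e b' a c b
  simp only [LinearMap.compl₂_apply, LinearMap.comp_apply, LinearMap.mul_apply',
    TensorProduct.AlgebraTensorModule.curry_apply, LinearMap.restrictScalars_self,
    TensorProduct.curry_apply, preLeft_tmul, preRight_tmul, LinearMap.id_apply,
    homRight_mul_homLeft, mul_left_eq]

theorem range_eq_top_of_span {f : A ⊗[ℂ] C →ₗ[ℂ] C} {S : Set C} (hS : Submodule.span ℂ S = ⊤)
    (h : ∀ x ∈ S, ∃ (a : A) (c : C), x = f (a ⊗ₜ c)) : LinearMap.range f = ⊤ := by
  rw [eq_top_iff, ← hS, Submodule.span_le]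
  intro x hx
  obtain ⟨a, c, rfl⟩ := h x hx
  exact ⟨_, rfl⟩

theorem preLeft_range (θ : A →ₙₐ[ℂ] Multiplier C) (hθ : IsNondegenerateHom θ) :
    LinearMap.range (preLeft (B := B) θ LinearMap.id) = ⊤ := by
  have h1 : preLeft (B := B) θ LinearMap.id =
      LinearMap.rTensor B (TensorProduct.lift
        { toFun := fun a => left (θ a)
          map_add' := fun a b => by ext; simp
          map_smul' := fun r a => by ext; simp }) := by
    ext a c b
    rfl
  rw [h1, LinearMap.range_eq_top]
  apply LinearMap.rTensor_surjective
  rw [← LinearMap.range_eq_top]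
  refine range_eq_top_of_span hθ.1 ?_
  rintro x ⟨a, c, rfl⟩
  exact ⟨a, c, rfl⟩

theorem preRight_range (θ : A →ₙₐ[ℂ] Multiplier C) (hθ : IsNondegenerateHom θ) :
    LinearMap.range (preRight (B := B) θ LinearMap.id) = ⊤ := by
  have h1 : preRight (B := B) θ LinearMap.id =
      LinearMap.rTensor B (TensorProduct.lift
        { toFun := fun a => right (θ a)
          map_add' := fun a b => by ext; simp
          map_smul' := fun r a => by ext; simp }) := by
    ext a c b
    rfl
  rw [h1, LinearMap.range_eq_top]
  apply LinearMap.rTensor_surjective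
  rw [← LinearMap.range_eq_top]
  refine range_eq_top_of_span hθ.2 ?_
  rintro x ⟨a, c, rfl⟩
  exact ⟨a, c, rfl⟩

/-- A linear right inverse of a surjective linear map. -/
noncomputable def linearSection {V W : Type*} [AddCommGroup V] [Module ℂ V] [AddCommGroup W]
    [Module ℂ W] (f : V →ₗ[ℂ] W) (hf : LinearMap.range f = ⊤) : W →ₗ[ℂ] V :=
  (f.exists_rightInverse_of_surjective hf).choose

theorem linearSection_spec {V W : Type*} [AddCommGroup V] [Module ℂ V] [AddCommGroup W]
    [Module ℂ W] (f : V →ₗ[ℂ] W) (hf : LinearMap.range f = ⊤) (w : W) :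
    f (linearSection f hf w) = w :=
  LinearMap.congr_fun (f.exists_rightInverse_of_surjective hf).choose_spec w

section
variable [IsNondegenerate B] [IsNondegenerate C]

theorem preLeft_eq (θ : A →ₙₐ[ℂ] Multiplier C) (hθ : IsNondegenerateHom θ)
    (V : Multiplier (A ⊗[ℂ] B)) {s t : (A ⊗[ℂ] C) ⊗[ℂ] B}
    (h : preLeft θ LinearMap.id s = preLeft θ LinearMap.id t) :
    preLeft θ (left V) s = preLeft θ (left V) t := by
  rw [← sub_eq_zero, ← map_sub]
  refine IsNondegenerate.eq_zero_of_mul_left _ fun y => ?_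
  rw [← linearSection_spec _ (preRight_range θ hθ) y, preRight_mul_preLeft, map_sub, h, sub_self,
    mul_zero]

theorem preRight_eq (θ : A →ₙₐ[ℂ] Multiplier C) (hθ : IsNondegenerateHom θ)
    (V : Multiplier (A ⊗[ℂ] B)) {s t : (A ⊗[ℂ] C) ⊗[ℂ] B}
    (h : preRight θ LinearMap.id s = preRight θ LinearMap.id t) :
    preRight θ (right V) s = preRight θ (right V) t := by
  rw [← sub_eq_zero, ← map_sub]
  refine IsNondegenerate.eq_zero_of_mul_right _ fun y => ?_
  rw [← linearSection_spec _ (preLeft_range θ hθ) y, ← preRight_mul_preLeft, map_sub, h, sub_self,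
    zero_mul]

/-- For a non-degenerate homomorphism `θ : A → M(C)`, the extension
`θ ⊙ ι : M(A ⊗ B) → M(C ⊗ B)` of the homomorphism `a ⊗ b ↦ θ(a) ⊗ b`. It is determined by
`(θ ⊙ ι)(V) (θ(a) c ⊗ b) = (θ ⊙ ι)(V (a ⊗ b)) (c ⊗ 1)` and
`(c θ(a) ⊗ b) (θ ⊙ ι)(V) = (c ⊗ 1) (θ ⊙ ι)((a ⊗ b) V)`. -/
noncomputable def extFst (θ : A →ₙₐ[ℂ] Multiplier C) (hθ : IsNondegenerateHom θ)
    (V : Multiplier (A ⊗[ℂ] B)) : Multiplier (C ⊗[ℂ] B) :=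
  have key : ∀ y z : C ⊗[ℂ] B,
      y * preLeft θ (left V) (linearSection _ (preLeft_range θ hθ) z) =
        preRight θ (right V) (linearSection _ (preRight_range θ hθ) y) * z := fun y z => by
    conv_lhs => rw [← linearSection_spec _ (preRight_range θ hθ) y, preRight_mul_preLeft,
      linearSection_spec]
  mk (preLeft θ (left V) ∘ₗ linearSection _ (preLeft_range θ hθ))
    (preRight θ (right V) ∘ₗ linearSection _ (preRight_range θ hθ))
    (fun y z => by
      rw [← sub_eq_zero]
      refine IsNondegenerate.eq_zero_of_mul_left _ fun x => ?_
      simp only [LinearMap.comp_apply]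
      rw [mul_sub, key, ← mul_assoc x, key, mul_assoc, sub_self])
    (fun y z => by
      rw [← sub_eq_zero]
      refine IsNondegenerate.eq_zero_of_mul_right _ fun x => ?_
      simp only [LinearMap.comp_apply]
      rw [sub_mul, ← key, mul_assoc, mul_assoc, ← key, sub_self])
    key

theorem left_extFst (θ : A →ₙₐ[ℂ] Multiplier C) (hθ : IsNondegenerateHom θ)
    (V : Multiplier (A ⊗[ℂ] B)) (a : A) (b : B) (c : C) :
    left (extFst θ hθ V) (left (θ a) c ⊗ₜ b) = homLeft θ (left V (a ⊗ₜ b)) c := by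
  rw [← preLeft_tmul]
  exact preLeft_eq θ hθ V (linearSection_spec _ _ _)

theorem right_extFst (θ : A →ₙₐ[ℂ] Multiplier C) (hθ : IsNondegenerateHom θ)
    (V : Multiplier (A ⊗[ℂ] B)) (a : A) (b : B) (c : C) :
    right (extFst θ hθ V) (right (θ a) c ⊗ₜ b) = homRight θ (right V (a ⊗ₜ b)) c := by
  rw [← preRight_tmul]
  exact preRight_eq θ hθ V (linearSection_spec _ _ _)

theorem left_extFst_of_eq (θ : A →ₙₐ[ℂ] Multiplier C) (hθ : IsNondegenerateHom θ)
    (V : Multiplier (A ⊗[ℂ] B)) (b : B) (z : A ⊗[ℂ] B)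
    (h : ∀ a, left V (a ⊗ₜ b) = TensorProduct.map (LinearMap.mulRight ℂ a) LinearMap.id z) (c : C) :
    left (extFst θ hθ V) (c ⊗ₜ b) = homLeft θ z c := by
  have key : (left (extFst θ hθ V)) ∘ₗ (TensorProduct.mk ℂ C B).flip b = homLeft θ z := by
    refine LinearMap.ext_on hθ.1 ?_
    rintro x ⟨a, d, rfl⟩
    simp only [LinearMap.comp_apply, LinearMap.flip_apply, TensorProduct.mk_apply, left_extFst, h]
    clear h
    induction z with
    | zero => simp
    | add z z' hz hz' => simp only [map_add, LinearMap.add_apply, hz, hz']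
    | tmul p q => simp
  exact LinearMap.congr_fun key c

end

theorem comm_mul (x y : A ⊗[ℂ] B) : TensorProduct.comm ℂ A B (x * y) =
    TensorProduct.comm ℂ A B x * TensorProduct.comm ℂ A B y := by
  induction x with
  | zero => simp
  | add x x' hx hx' => simp [add_mul, hx, hx']
  | tmul a b =>
    induction y with
    | zero => simp
    | add x x' hx hx' => simp [mul_add, hx, hx']
    | tmul a b => simp

theorem assoc_mul (x y : (A ⊗[ℂ] B) ⊗[ℂ] C) : TensorProduct.assoc ℂ A B C (x * y) =
    TensorProduct.assoc ℂ A B C x * TensorProduct.assoc ℂ A B C y := by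
  induction x with
  | zero => simp
  | add x x' hx hx' => simp only [add_mul, map_add, hx, hx']
  | tmul x c =>
    induction y with
    | zero => simp
    | add y y' hy hy' => simp only [mul_add, map_add, hy, hy']
    | tmul y d =>
      induction x with
      | zero => simp
      | add x x' hx hx' =>
        simp only [TensorProduct.add_tmul, add_mul, map_add, hx, hx']
      | tmul a b =>
        induction y with
        | zero => simp
        | add y y' hy hy' =>
          simp only [TensorProduct.add_tmul, mul_add, map_add, hy, hy']
        | tmul a b => simp

theorem rightComm_mul (x y : (A ⊗[ℂ] B) ⊗[ℂ] C) : TensorProduct.rightComm ℂ A B C (x * y) =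
    TensorProduct.rightComm ℂ A B C x * TensorProduct.rightComm ℂ A B C y := by
  induction x with
  | zero => simp
  | add x x' hx hx' => simp only [add_mul, map_add, hx, hx']
  | tmul x c =>
    induction y with
    | zero => simp
    | add y y' hy hy' => simp only [mul_add, map_add, hy, hy']
    | tmul y d =>
      induction x with
      | zero => simp
      | add x x' hx hx' =>
        simp only [TensorProduct.add_tmul, add_mul, map_add, hx, hx']
      | tmul a b =>
        induction y with
        | zero => simp
        | add y y' hy hy' =>
          simp only [TensorProduct.add_tmul, mul_add, map_add, hy, hy']
        | tmul a b => simp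

theorem assoc_symm_mul (x y : A ⊗[ℂ] (B ⊗[ℂ] C)) : (TensorProduct.assoc ℂ A B C).symm (x * y) =
    (TensorProduct.assoc ℂ A B C).symm x * (TensorProduct.assoc ℂ A B C).symm y :=
  (TensorProduct.assoc ℂ A B C).injective (by simp only [assoc_mul, LinearEquiv.apply_symm_apply])

/-- For a non-degenerate homomorphism `θ : A → M(C)`, the extension
`ι ⊙ θ : M(B ⊗ A) → M(B ⊗ C)` of the homomorphism `b ⊗ a ↦ b ⊗ θ(a)`. -/
noncomputable def extSnd [IsNondegenerate B] [IsNondegenerate C] (θ : A →ₙₐ[ℂ] Multiplier C)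
    (hθ : IsNondegenerateHom θ) (V : Multiplier (B ⊗[ℂ] A)) : Multiplier (B ⊗[ℂ] C) :=
  transport (TensorProduct.comm ℂ C B) comm_mul
    (extFst θ hθ (transport (TensorProduct.comm ℂ B A) comm_mul V))

/-- For `V ∈ M(A ⊗ B)`, the element `V₁₃` of `M(A ⊗ A ⊗ B)`. -/
def leg13 (V : Multiplier (A ⊗[ℂ] B)) : Multiplier ((A ⊗[ℂ] A) ⊗[ℂ] B) :=
  transport (TensorProduct.rightComm ℂ A B A) rightComm_mul (tensor V 1)

/-- For `V ∈ M(A ⊗ B)`, the element `V₂₃` of `M(A ⊗ A ⊗ B)`. -/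
def leg23 (V : Multiplier (A ⊗[ℂ] B)) : Multiplier ((A ⊗[ℂ] A) ⊗[ℂ] B) :=
  transport (TensorProduct.assoc ℂ A A B).symm assoc_symm_mul (tensor 1 V)

end Extension

section QuantumGroup

open Multiplier

variable (A : Type*) [NonUnitalRing A] [Module ℂ A] [IsScalarTower ℂ A A] [SMulCommClass ℂ A A]
  [IsNondegenerate A]

/-- A regular multiplier Hopf algebra structure on a non-degenerate algebra `A`. The four
bijections `T₁, …, T₄` of `A ⊗ A` are determined by `Δ`, since `A ⊗ A` embeds in `M(A ⊗ A)`. -/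
structure RegularMultiplierHopfAlgebra where
  /-- the comultiplication -/
  Δ : A →ₙₐ[ℂ] Multiplier (A ⊗[ℂ] A)
  Δ_nondeg : IsNondegenerateHom Δ
  coassoc : ∀ a : A, transport (TensorProduct.assoc ℂ A A A) assoc_mul (extFst Δ Δ_nondeg (Δ a)) =
    extSnd Δ Δ_nondeg (Δ a)
  /-- `T₁ (a ⊗ b) = Δ(a) (b ⊗ 1)` -/
  T₁ : A ⊗[ℂ] A ≃ₗ[ℂ] A ⊗[ℂ] A
  T₁_spec : ∀ a b : A, incl (T₁ (a ⊗ₜ b)) = Δ a * tensor (incl b) 1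
  /-- `T₂ (a ⊗ b) = Δ(a) (1 ⊗ b)` -/
  T₂ : A ⊗[ℂ] A ≃ₗ[ℂ] A ⊗[ℂ] A
  T₂_spec : ∀ a b : A, incl (T₂ (a ⊗ₜ b)) = Δ a * tensor 1 (incl b)
  /-- `T₃ (a ⊗ b) = (b ⊗ 1) Δ(a)` -/
  T₃ : A ⊗[ℂ] A ≃ₗ[ℂ] A ⊗[ℂ] A
  T₃_spec : ∀ a b : A, incl (T₃ (a ⊗ₜ b)) = tensor (incl b) 1 * Δ a
  /-- `T₄ (a ⊗ b) = (1 ⊗ b) Δ(a)` -/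
  T₄ : A ⊗[ℂ] A ≃ₗ[ℂ] A ⊗[ℂ] A
  T₄_spec : ∀ a b : A, incl (T₄ (a ⊗ₜ b)) = tensor 1 (incl b) * Δ a

variable {A}

theorem sliceSnd_left (ω : Module.Dual ℂ A) (b : A) (z : A ⊗[ℂ] A) :
    sliceSnd ω (left (tensor (incl b) 1) z) = b * sliceSnd ω z := by
  induction z with
  | zero => simp
  | add z z' hz hz' => simp only [map_add, mul_add, hz, hz']
  | tmul p q => simp [mul_smul_comm]

theorem sliceSnd_right (ω : Module.Dual ℂ A) (b : A) (z : A ⊗[ℂ] A) :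
    sliceSnd ω (right (tensor (incl b) 1) z) = sliceSnd ω z * b := by
  induction z with
  | zero => simp
  | add z z' hz hz' => simp only [map_add, add_mul, hz, hz']
  | tmul p q => simp [smul_mul_assoc]

namespace RegularMultiplierHopfAlgebra

variable (Q : RegularMultiplierHopfAlgebra A)

theorem T₃_T₁ (a b c : A) : right (tensor (incl b) 1) (Q.T₃ (a ⊗ₜ c)) =
    left (tensor (incl c) 1) (Q.T₁ (a ⊗ₜ b)) := by
  apply incl_injective
  rw [incl_right, incl_left, Q.T₁_spec, Q.T₃_spec, mul_assoc]

/-- For `ω ∈ A'` and `a ∈ A`, the element `(ι ⊙ ω)Δ(a)` of `M(A)`, given by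
`[(ι ⊙ ω)Δ(a)] b = (ι ⊙ ω)(Δ(a) (b ⊗ 1))` and `b [(ι ⊙ ω)Δ(a)] = (ι ⊙ ω)((b ⊗ 1) Δ(a))`. -/
def sndSlice (ω : Module.Dual ℂ A) (a : A) : Multiplier A :=
  have key : ∀ b c : A, b * sliceSnd ω (Q.T₁ (a ⊗ₜ c)) = sliceSnd ω (Q.T₃ (a ⊗ₜ b)) * c :=
    fun b c => by rw [← sliceSnd_left, ← sliceSnd_right, T₃_T₁]
  Multiplier.mk (sliceSnd ω ∘ₗ Q.T₁.toLinearMap ∘ₗ TensorProduct.mk ℂ A A a)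
    (sliceSnd ω ∘ₗ Q.T₃.toLinearMap ∘ₗ TensorProduct.mk ℂ A A a)
    (fun b c => by
      rw [← sub_eq_zero]
      refine IsNondegenerate.eq_zero_of_mul_left _ fun x => ?_
      simp only [LinearMap.comp_apply, TensorProduct.mk_apply, LinearEquiv.coe_coe]
      rw [mul_sub, key, ← mul_assoc x, key, mul_assoc, sub_self])
    (fun b c => by
      rw [← sub_eq_zero]
      refine IsNondegenerate.eq_zero_of_mul_right _ fun x => ?_
      simp only [LinearMap.comp_apply, TensorProduct.mk_apply, LinearEquiv.coe_coe]
      rw [sub_mul, ← key, mul_assoc, mul_assoc, ← key, sub_self])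
    key

theorem left_sndSlice (ω : Module.Dual ℂ A) (a b : A) :
    left (Q.sndSlice ω a) b = sliceSnd ω (Q.T₁ (a ⊗ₜ b)) := rfl

theorem right_sndSlice (ω : Module.Dual ℂ A) (a b : A) :
    right (Q.sndSlice ω a) b = sliceSnd ω (Q.T₃ (a ⊗ₜ b)) := rfl

variable {B : Type*} [NonUnitalRing B] [Module ℂ B] [IsScalarTower ℂ B B] [SMulCommClass ℂ B B]
  [IsNondegenerate B]

/-- `V ∈ M(A ⊗ B)` is a corepresentation on `B` if `(Δ ⊙ ι)(V) = V₁₃ V₂₃`. -/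
def IsCorepresentation (V : Multiplier (A ⊗[ℂ] B)) : Prop :=
  extFst Q.Δ Q.Δ_nondeg V = leg13 V * leg23 V

end RegularMultiplierHopfAlgebra

variable (A) in
/-- An algebraic quantum group with a chosen left Haar functional `φ`: a non-zero linear
functional with `(ι ⊙ φ)Δ(a) = φ(a) 1` for all `a`. -/
structure AlgebraicQuantumGroup extends RegularMultiplierHopfAlgebra A where
  /-- the left Haar functional -/
  φ : Module.Dual ℂ A
  φ_ne_zero : φ ≠ 0
  left_invariant : ∀ a : A, toRegularMultiplierHopfAlgebra.sndSlice φ a = φ a • 1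

namespace AlgebraicQuantumGroup

variable (Q : AlgebraicQuantumGroup A)

/-- The action `a ω` of `a ∈ A` on `ω ∈ A'`, `(a ω)(x) = ω(x a)`, bilinear in `a` and `ω`. -/
def act : A →ₗ[ℂ] Module.Dual ℂ A →ₗ[ℂ] Module.Dual ℂ A :=
  LinearMap.mk₂ ℂ (fun a ω => ω ∘ₗ LinearMap.mulRight ℂ a)
    (fun a a' ω => by ext; simp [mul_add]) (fun r a ω => by ext; simp [mul_smul_comm])
    (fun a ω ω' => by ext; simp) (fun r a ω => by ext; simp)

@[simp] theorem act_apply (a x : A) (ω : Module.Dual ℂ A) : act a ω x = ω (x * a) := rfl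

/-- The underlying space `Â = {a φ | a ∈ A}` of the dual, a subspace of `A'`. -/
def dual : Submodule ℂ (Module.Dual ℂ A) := LinearMap.range (act.flip Q.φ)

/-- An element `a` with `ω = a φ`, chosen linearly in `ω ∈ Â`. -/
noncomputable def rep : Q.dual →ₗ[ℂ] A :=
  linearSection (act.flip Q.φ).rangeRestrict (LinearMap.range_rangeRestrict _)

theorem act_rep (ω : Q.dual) : act (Q.rep ω) Q.φ = ω :=
  congrArg Subtype.val (linearSection_spec (act.flip Q.φ).rangeRestrict _ ω)

/-- The element `a φ` of `Â`. -/
def toDual (a : A) : Q.dual := ⟨act a Q.φ, a, rfl⟩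

@[simp] theorem coe_toDual (a : A) : (Q.toDual a : Module.Dual ℂ A) = act a Q.φ := rfl

theorem toDual_rep (ω : Q.dual) : Q.toDual (Q.rep ω) = ω := Subtype.ext (Q.act_rep ω)

/-- For `ω ∈ Â` and `x ∈ A`, the element `(ι ⊙ ω)Δ(x)`, which belongs to `A`
(see `incl_dualSlice`). -/
noncomputable def dualSlice (ω : Q.dual) : A →ₗ[ℂ] A :=
  sliceSnd Q.φ ∘ₗ Q.T₂.toLinearMap ∘ₗ (TensorProduct.mk ℂ A A).flip (Q.rep ω)

theorem T₂_T₁ (x a b : A) : right (tensor (incl b) 1) (Q.T₂ (x ⊗ₜ a)) =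
    right (tensor 1 (incl a)) (Q.T₁ (x ⊗ₜ b)) := by
  apply incl_injective
  rw [incl_right, incl_right, Q.T₁_spec, Q.T₂_spec, mul_assoc, mul_assoc]
  congr 1
  refine Multiplier.ext ?_ ?_ <;> ext p q <;> simp

theorem sliceSnd_act (ω : Module.Dual ℂ A) (a : A) (z : A ⊗[ℂ] A) :
    sliceSnd (act a ω) z = sliceSnd ω (right (tensor 1 (incl a)) z) := by
  induction z with
  | zero => simp
  | add z z' hz hz' => simp only [map_add, hz, hz']
  | tmul p q => simp

theorem sliceSnd_T₂ (x a b : A) : sliceSnd Q.φ (Q.T₂ (x ⊗ₜ a)) * b =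
    sliceSnd (act a Q.φ) (Q.T₁ (x ⊗ₜ b)) := by
  rw [← sliceSnd_right, T₂_T₁, sliceSnd_act]

theorem incl_dualSlice (ω : Q.dual) (x : A) :
    incl (Q.dualSlice ω x) = Q.sndSlice (ω : Module.Dual ℂ A) x := by
  have h : ∀ b, Q.dualSlice ω x * b = left (Q.sndSlice (ω : Module.Dual ℂ A) x) b := fun b => by
    rw [Q.left_sndSlice, ← Q.act_rep ω, ← sliceSnd_T₂]
    rfl
  refine Multiplier.ext (LinearMap.ext h) (LinearMap.ext fun b => ?_)
  rw [← sub_eq_zero]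
  refine IsNondegenerate.eq_zero_of_mul_right _ fun c => ?_
  rw [sub_mul, ← mul_left_eq, ← mul_left_eq, left_incl, h, sub_self]

theorem dualSlice_eq (ω : Q.dual) (a x : A) (h : (ω : Module.Dual ℂ A) = act a Q.φ) :
    Q.dualSlice ω x = sliceSnd Q.φ (Q.T₂ (x ⊗ₜ a)) := by
  rw [← sub_eq_zero]
  refine IsNondegenerate.eq_zero_of_mul_right _ fun b => ?_
  rw [sub_mul, sliceSnd_T₂, ← h, ← left_incl, incl_dualSlice]
  exact sub_self _

/-- The functional `φ ⊙ φ`. -/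
def φφ : Module.Dual ℂ (A ⊗[ℂ] A) := Q.φ ∘ₗ sliceSnd Q.φ

@[simp] theorem φφ_tmul (a b : A) : Q.φφ (a ⊗ₜ b) = Q.φ a * Q.φ b := by
  simp [φφ, mul_comm]

theorem φφ_T₁ (z : A ⊗[ℂ] A) : Q.φφ (Q.T₁ z) = Q.φφ z := by
  induction z with
  | zero => simp
  | add z z' hz hz' => simp only [map_add, hz, hz']
  | tmul a b =>
    have := congrArg (fun m => left m b) (Q.left_invariant a)
    simp only [Q.left_sndSlice, left_smul, left_one] at this
    simp [φφ, this, mul_comm]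

theorem left_Δ_T₁ (x : A) (t : A ⊗[ℂ] A) : Q.φφ (left (Q.Δ x) (Q.T₁ t)) =
    Q.φ (x * sliceSnd Q.φ t) := by
  have h : ∀ y z : A, left (Q.Δ x) (Q.T₁ (y ⊗ₜ z)) = Q.T₁ ((x * y) ⊗ₜ z) := fun y z => by
    apply incl_injective
    rw [incl_left, Q.T₁_spec, Q.T₁_spec, map_mul, mul_assoc]
  induction t with
  | zero => simp
  | add z z' hz hz' => simp only [map_add, mul_add, hz, hz']
  | tmul a b => simp [h, φφ_T₁, mul_comm, mul_smul_comm]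

theorem right_T₂ (x a c : A) :
    right (tensor (incl c) 1) (Q.T₂ (x ⊗ₜ a)) = left (Q.Δ x) (c ⊗ₜ a) := by
  apply incl_injective
  rw [incl_right, incl_left, Q.T₂_spec, mul_assoc]
  congr 1
  refine Multiplier.ext ?_ ?_ <;> ext p q <;> simp

theorem right_T₁ (x a c : A) :
    right (tensor 1 (incl c)) (Q.T₁ (x ⊗ₜ a)) = left (Q.Δ x) (a ⊗ₜ c) := by
  apply incl_injective
  rw [incl_right, incl_left, Q.T₁_spec, mul_assoc]
  congr 1
  refine Multiplier.ext ?_ ?_ <;> ext p q <;> simp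

/-- `ω₁((ι ⊙ ω₂)Δ(x)) = (φ ⊙ φ)(Δ(x) (c ⊗ a))` if `ω₁ = c φ` and `ω₂ = a φ`. -/
theorem apply_dualSlice (ω₁ ω₂ : Q.dual) (x c a : A) (h₁ : (ω₁ : Module.Dual ℂ A) = act c Q.φ)
    (h₂ : (ω₂ : Module.Dual ℂ A) = act a Q.φ) :
    (ω₁ : Module.Dual ℂ A) (Q.dualSlice ω₂ x) = Q.φφ (left (Q.Δ x) (c ⊗ₜ a)) := by
  rw [h₁, Q.dualSlice_eq ω₂ a x h₂, act_apply, ← sliceSnd_right, right_T₂]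
  rfl

theorem comp_dualSlice_mem (ω₁ ω₂ : Q.dual) :
    (ω₁ : Module.Dual ℂ A) ∘ₗ Q.dualSlice ω₂ ∈ Q.dual := by
  refine ⟨sliceSnd Q.φ (Q.T₁.symm (Q.rep ω₁ ⊗ₜ Q.rep ω₂)), LinearMap.ext fun x => ?_⟩
  rw [LinearMap.flip_apply, act_apply, ← left_Δ_T₁, LinearEquiv.apply_symm_apply,
    LinearMap.comp_apply, Q.apply_dualSlice ω₁ ω₂ x _ _ (Q.act_rep ω₁).symm (Q.act_rep ω₂).symm]

/-- The product of `Â`: `(ω₁ ω₂)(x) = ω₁((ι ⊙ ω₂)Δ(x))`. -/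
noncomputable instance : Mul Q.dual where
  mul ω₁ ω₂ := ⟨(ω₁ : Module.Dual ℂ A) ∘ₗ Q.dualSlice ω₂, Q.comp_dualSlice_mem ω₁ ω₂⟩

theorem dual_mul_apply (ω₁ ω₂ : Q.dual) (x : A) :
    ((ω₁ * ω₂ : Q.dual) : Module.Dual ℂ A) x = (ω₁ : Module.Dual ℂ A) (Q.dualSlice ω₂ x) := rfl

/-- The functional `(φ ⊙ φ) ⊙ φ`. -/
def φφφ : Module.Dual ℂ ((A ⊗[ℂ] A) ⊗[ℂ] A) := Q.φφ ∘ₗ sliceSnd Q.φ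

theorem coassoc_left (x a b c : A) :
    left (extFst Q.Δ Q.Δ_nondeg (Q.Δ x)) ((a ⊗ₜ b) ⊗ₜ c) =
      homLeft Q.Δ (Q.T₂ (x ⊗ₜ c)) (a ⊗ₜ b) :=
  left_extFst_of_eq _ _ _ _ _ (fun p => by
    rw [← right_T₂, right_tensor]
    congr 1) _

theorem coassoc_right (x a b c : A) :
    left (extSnd Q.Δ Q.Δ_nondeg (Q.Δ x)) (a ⊗ₜ (b ⊗ₜ c)) =
      TensorProduct.comm ℂ (A ⊗[ℂ] A) A
        (homLeft Q.Δ (TensorProduct.comm ℂ A A (Q.T₁ (x ⊗ₜ a))) (b ⊗ₜ c)) := by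
  rw [extSnd, left_transport, TensorProduct.comm_symm_tmul]
  congr 1
  refine left_extFst_of_eq _ _ _ _ _ (fun p => ?_) _
  rw [left_transport, TensorProduct.comm_symm_tmul, ← right_T₁, right_tensor]
  generalize Q.T₁ (x ⊗ₜ a) = z
  induction z with
  | zero => simp
  | add z z' hz hz' => simp only [map_add, hz, hz']
  | tmul p q => simp [LinearMap.mulRight]

theorem dual_mul_assoc_left (ω₁ ω₂ ω₃ : Q.dual) (x a b c : A)
    (h₁ : (ω₁ : Module.Dual ℂ A) = act a Q.φ) (h₂ : (ω₂ : Module.Dual ℂ A) = act b Q.φ)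
    (h₃ : (ω₃ : Module.Dual ℂ A) = act c Q.φ) :
    ((ω₁ * ω₂ * ω₃ : Q.dual) : Module.Dual ℂ A) x =
      Q.φφφ (left (extFst Q.Δ Q.Δ_nondeg (Q.Δ x)) ((a ⊗ₜ b) ⊗ₜ c)) := by
  rw [coassoc_left, dual_mul_apply, dual_mul_apply, Q.apply_dualSlice ω₁ ω₂ _ a b h₁ h₂,
    Q.dualSlice_eq ω₃ c x h₃]
  generalize Q.T₂ (x ⊗ₜ c) = z
  induction z with
  | zero => simp
  | add z z' hz hz' => simp only [map_add, LinearMap.add_apply, left_add, hz, hz']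
  | tmul p q => simp [φφφ]

theorem dual_mul_assoc_right (ω₁ ω₂ ω₃ : Q.dual) (x a b c : A)
    (h₁ : (ω₁ : Module.Dual ℂ A) = act a Q.φ) (h₂ : (ω₂ : Module.Dual ℂ A) = act b Q.φ)
    (h₃ : (ω₃ : Module.Dual ℂ A) = act c Q.φ) :
    ((ω₁ * (ω₂ * ω₃) : Q.dual) : Module.Dual ℂ A) x =
      Q.φφφ ((TensorProduct.assoc ℂ A A A).symm
        (left (extSnd Q.Δ Q.Δ_nondeg (Q.Δ x)) (a ⊗ₜ (b ⊗ₜ c)))) := by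
  have h : (ω₁ : Module.Dual ℂ A) (Q.dualSlice (ω₂ * ω₃) x) =
      Q.φ (sliceSnd ((ω₂ * ω₃ : Q.dual) : Module.Dual ℂ A) (Q.T₁ (x ⊗ₜ a))) := by
    rw [h₁, act_apply, Q.dualSlice_eq (ω₂ * ω₃) _ x (Q.act_rep _).symm, sliceSnd_T₂, act_rep]
  rw [coassoc_right, dual_mul_apply, h]
  generalize Q.T₁ (x ⊗ₜ a) = z
  induction z with
  | zero => simp
  | add z z' hz hz' => simp only [map_add, LinearMap.add_apply, hz, hz']
  | tmul p q =>
    simp only [sliceSnd_tmul, map_smul, dual_mul_apply, Q.apply_dualSlice ω₂ ω₃ _ b c h₂ h₃,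
      TensorProduct.comm_tmul, homLeft_tmul]
    generalize left (Q.Δ q) (b ⊗ₜ c) = z
    induction z with
    | zero => simp
    | add z z' hz hz' =>
      simp only [map_add, TensorProduct.add_tmul, TensorProduct.tmul_add, add_smul, hz, hz']
    | tmul r s => simp [φφφ]; ring

/-- `Â` is an algebra. -/
noncomputable instance : NonUnitalRing Q.dual where
  left_distrib ω₁ ω₂ ω₃ := Subtype.ext (LinearMap.ext fun x => by
    simp [dual_mul_apply, dualSlice])
  right_distrib ω₁ ω₂ ω₃ := Subtype.ext (LinearMap.ext fun x => by
    simp [dual_mul_apply])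
  zero_mul ω := Subtype.ext (LinearMap.ext fun x => by simp [dual_mul_apply])
  mul_zero ω := Subtype.ext (LinearMap.ext fun x => by simp [dual_mul_apply, dualSlice])
  mul_assoc ω₁ ω₂ ω₃ := Subtype.ext (LinearMap.ext fun x => by
    rw [Q.dual_mul_assoc_left ω₁ ω₂ ω₃ x _ _ _ (Q.act_rep _).symm (Q.act_rep _).symm
      (Q.act_rep _).symm, Q.dual_mul_assoc_right ω₁ ω₂ ω₃ x _ _ _ (Q.act_rep _).symm
      (Q.act_rep _).symm (Q.act_rep _).symm, ← Q.coassoc, left_transport]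
    simp)

instance : IsScalarTower ℂ Q.dual Q.dual where
  smul_assoc r ω₁ ω₂ := Subtype.ext (LinearMap.ext fun x => by simp [dual_mul_apply])

instance : SMulCommClass ℂ Q.dual Q.dual where
  smul_comm r ω₁ ω₂ := Subtype.ext (LinearMap.ext fun x => by
    simp [dual_mul_apply, dualSlice])

/-- The canonical embedding of `A ⊗ Â` into the linear operators on `A`, which sends `a ⊗ ω` to
`y ↦ ω(y) a`. -/
def toOp : A ⊗[ℂ] Q.dual →ₗ[ℂ] A →ₗ[ℂ] A :=
  TensorProduct.lift (LinearMap.mk₂ ℂ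
    (fun a ω => (LinearMap.toSpanSingleton ℂ A a) ∘ₗ (ω : Module.Dual ℂ A))
    (fun a a' ω => by ext; simp) (fun r a ω => LinearMap.ext fun y => smul_comm _ _ _)
    (fun a ω ω' => by ext; simp [add_smul]) (fun r a ω => by ext; simp [mul_smul]))

@[simp] theorem toOp_tmul (a : A) (ω : Q.dual) (y : A) :
    Q.toOp (a ⊗ₜ ω) y = (ω : Module.Dual ℂ A) y • a := rfl

/-- `U` is the universal corepresentation: the multiplier of `A ⊗ Â` with
`[U (x ⊗ ω)](y) = (ι ⊙ ω)(Δ(y) (x ⊗ 1))` and `[(x ⊗ ω) U](y) = (ω ⊙ ι)((1 ⊗ x) Δ(y))`, where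
`A ⊗ Â` is regarded as a space of operators on `A`. -/
def IsUniversalCorepresentation (U : Multiplier (A ⊗[ℂ] Q.dual)) : Prop :=
  ∀ (x y : A) (ω : Q.dual),
    Q.toOp (left U (x ⊗ₜ ω)) y = sliceSnd (ω : Module.Dual ℂ A) (Q.T₁ (y ⊗ₜ x)) ∧
    Q.toOp (right U (x ⊗ₜ ω)) y = sliceFst (ω : Module.Dual ℂ A) (Q.T₄ (y ⊗ₜ x))

end AlgebraicQuantumGroup

section leftSlice

open AlgebraicQuantumGroup (act act_apply)

variable {B : Type*} [NonUnitalRing B] [Module ℂ B] [IsScalarTower ℂ B B] [SMulCommClass ℂ B B]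
  [IsNondegenerate B]

variable (A) in
/-- The subspace `A°` of `A'` spanned by the functionals `a ω` with `a ∈ A`, `ω ∈ A'`. -/
def circ : Submodule ℂ (Module.Dual ℂ A) :=
  Submodule.span ℂ {θ | ∃ (a : A) (ω : Module.Dual ℂ A), θ = act a ω}

theorem act_mem_circ (a : A) (ω : Module.Dual ℂ A) : act a ω ∈ circ A :=
  Submodule.subset_span ⟨a, ω, rfl⟩

/-- The map `A ⊗ A' → A°` with `a ⊗ ω ↦ a ω`. -/
def actMap : A ⊗[ℂ] Module.Dual ℂ A →ₗ[ℂ] circ A :=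
  LinearMap.codRestrict (circ A) (TensorProduct.lift act) (fun t => by
    induction t with
    | zero => simp
    | add s t hs ht => rw [map_add]; exact add_mem hs ht
    | tmul a ω => exact act_mem_circ a ω)

theorem actMap_range : LinearMap.range (actMap (A := A)) = ⊤ := by
  rw [LinearMap.range_eq_top]
  rintro ⟨θ, hθ⟩
  have : circ A ≤ LinearMap.range (TensorProduct.lift (act (A := A))) := by
    refine Submodule.span_le.2 ?_
    rintro _ ⟨a, ω, rfl⟩
    exact ⟨a ⊗ₜ ω, rfl⟩
  obtain ⟨t, ht⟩ := this hθ
  exact ⟨t, Subtype.ext ht⟩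

theorem sliceFst_add (ω ω' : Module.Dual ℂ A) (z : A ⊗[ℂ] B) :
    sliceFst (ω + ω') z = sliceFst ω z + sliceFst ω' z := by
  simp [sliceFst, LinearMap.rTensor_add]

theorem sliceFst_smul (r : ℂ) (ω : Module.Dual ℂ A) (z : A ⊗[ℂ] B) :
    sliceFst (r • ω) z = r • sliceFst ω z := by
  simp [sliceFst, LinearMap.rTensor_smul]

theorem sliceFst_act (ω : Module.Dual ℂ A) (a : A) (z : A ⊗[ℂ] B) :
    sliceFst (act a ω) z = sliceFst ω (TensorProduct.map (LinearMap.mulRight ℂ a) LinearMap.id z) := by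
  induction z with
  | zero => simp
  | add z z' hz hz' => simp only [map_add, hz, hz']
  | tmul p q => simp

/-- The map `a ⊗ ω ↦ (x ↦ (ω ⊙ ι)(V (a ⊗ x)))`. -/
def preSlice (V : Multiplier (A ⊗[ℂ] B)) : A ⊗[ℂ] Module.Dual ℂ A →ₗ[ℂ] B →ₗ[ℂ] B :=
  TensorProduct.lift (LinearMap.mk₂ ℂ
    (fun a ω => sliceFst ω ∘ₗ left V ∘ₗ TensorProduct.mk ℂ A B a)
    (fun a a' ω => by ext; simp [TensorProduct.add_tmul])
    (fun r a ω => by ext; simp [← TensorProduct.smul_tmul'])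
    (fun a ω ω' => by ext; simp [sliceFst_add])
    (fun r a ω => by ext; simp [sliceFst_smul]))

@[simp] theorem preSlice_tmul (V : Multiplier (A ⊗[ℂ] B)) (a : A) (ω : Module.Dual ℂ A) (x : B) :
    preSlice V (a ⊗ₜ ω) x = sliceFst ω (left V (a ⊗ₜ x)) := rfl

/-- For `θ ∈ A°` and `V ∈ M(A ⊗ B)`, the left multiplier `(θ ⊙ ι)(V)` of `B`: the unique linear
map in `θ` with `(a ω ⊙ ι)(V) x = (ω ⊙ ι)(V (a ⊗ x))` (see `leftSlice_act`). -/
noncomputable def leftSlice (V : Multiplier (A ⊗[ℂ] B)) : circ A →ₗ[ℂ] B →ₗ[ℂ] B :=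
  preSlice V ∘ₗ linearSection actMap actMap_range

theorem left_tmul_mul (V : Multiplier (A ⊗[ℂ] B)) (a c : A) (x : B) :
    left V ((a * c) ⊗ₜ x) =
      TensorProduct.map (LinearMap.mulRight ℂ c) LinearMap.id (left V (a ⊗ₜ x)) := by
  have h := tensorNondegenerate (A := A) (B := B)
  have : ∀ (f : A) (e : B) (z : A ⊗[ℂ] B), (f ⊗ₜ e) *
      TensorProduct.map (LinearMap.mulRight ℂ c) LinearMap.id z =
      TensorProduct.map (LinearMap.mulRight ℂ c) LinearMap.id ((f ⊗ₜ e) * z) := fun f e z => by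
    induction z with
    | zero => simp
    | add z z' hz hz' => simp only [map_add, mul_add, hz, hz']
    | tmul p q => simp [mul_assoc]
  have this' : ∀ (y z : A ⊗[ℂ] B), y *
      TensorProduct.map (LinearMap.mulRight ℂ c) LinearMap.id z =
      TensorProduct.map (LinearMap.mulRight ℂ c) LinearMap.id (y * z) := fun y z => by
    induction y with
    | zero => simp
    | add z z' hz hz' => simp only [map_add, add_mul, hz, hz']
    | tmul p q => exact this p q z
  rw [← sub_eq_zero]
  refine h.eq_zero_of_mul_left _ fun y => ?_
  rw [mul_sub, mul_left_eq, this', mul_left_eq, ← this']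
  simp

theorem preSlice_eq_zero (Q : AlgebraicQuantumGroup A) (V : Multiplier (A ⊗[ℂ] B))
    (t : A ⊗[ℂ] Module.Dual ℂ A) (ht : actMap t = 0) : preSlice V t = 0 := by
  obtain ⟨d, hd⟩ : ∃ d, Q.φ d = 1 := by
    obtain ⟨d, hd⟩ : ∃ d, Q.φ d ≠ 0 := by
      by_contra! h
      exact Q.φ_ne_zero (LinearMap.ext h)
    exact ⟨(Q.φ d)⁻¹ • d, by simp [hd]⟩
  obtain ⟨S, rfl⟩ := TensorProduct.exists_finset t
  have hS : ∑ i ∈ S, act i.1 i.2 = 0 := by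
    have := congrArg Subtype.val ht
    simpa [actMap] using this
  ext x
  let G : A × Module.Dual ℂ A → A →ₗ[ℂ] B := fun i =>
    sliceFst i.2 ∘ₗ left V ∘ₗ (TensorProduct.mk ℂ A B).flip x
  let N : B ⊗[ℂ] A := ∑ i ∈ S, TensorProduct.map (G i) LinearMap.id (Q.T₁ (d ⊗ₜ i.1))
  have hN : N = 0 := by
    refine eq_zero_of_sliceFst _ fun η => IsNondegenerate.eq_zero_of_mul_left _ fun g => ?_
    have h1 : ∀ y : B ⊗[ℂ] A, g * sliceFst η y =
        sliceFst η (TensorProduct.map LinearMap.id (LinearMap.mulLeft ℂ g) y) := fun y => by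
      induction y with
      | zero => simp
      | add z z' hz hz' => simp only [map_add, mul_add, hz, hz']
      | tmul p q => simp [mul_smul_comm]
    have h2 : ∀ i : A × Module.Dual ℂ A, TensorProduct.map LinearMap.id (LinearMap.mulLeft ℂ g)
        (TensorProduct.map (G i) LinearMap.id (Q.T₁ (d ⊗ₜ i.1))) =
        TensorProduct.map (sliceFst (act i.1 i.2) ∘ₗ left V ∘ₗ (TensorProduct.mk ℂ A B).flip x)
          LinearMap.id (Q.T₄ (d ⊗ₜ g)) := fun i => by
      have h3 : left (tensor 1 (incl g)) (Q.T₁ (d ⊗ₜ i.1)) =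
          right (tensor (incl i.1) 1) (Q.T₄ (d ⊗ₜ g)) := by
        apply incl_injective
        rw [incl_left, incl_right, Q.T₁_spec, Q.T₄_spec, mul_assoc]
      have h4 : ∀ z : A ⊗[ℂ] A, TensorProduct.map LinearMap.id (LinearMap.mulLeft ℂ g)
          (TensorProduct.map (G i) LinearMap.id z) =
          TensorProduct.map (G i) LinearMap.id (left (tensor 1 (incl g)) z) := fun z => by
        induction z with
        | zero => simp
        | add z z' hz hz' => simp only [map_add, hz, hz']
        | tmul p q => simp
      rw [h4, h3]
      generalize Q.T₄ (d ⊗ₜ g) = z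
      induction z with
      | zero => simp
      | add z z' hz hz' => simp only [map_add, hz, hz']
      | tmul p q => simp [G, left_tmul_mul, sliceFst_act]
    rw [h1, map_sum, Finset.sum_congr rfl fun i _ => h2 i]
    have h5 : ∀ z : A ⊗[ℂ] A, ∑ i ∈ S, TensorProduct.map
        (sliceFst (act i.1 i.2) ∘ₗ left V ∘ₗ (TensorProduct.mk ℂ A B).flip x)
          LinearMap.id z = 0 := fun z => by
      induction z with
      | zero => simp
      | add z z' hz hz' => simp only [map_add, Finset.sum_add_distrib, hz, hz', add_zero]
      | tmul p q =>
        have h6 : ∀ (w : A ⊗[ℂ] B) (S : Finset (A × Module.Dual ℂ A)),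
            ∑ i ∈ S, sliceFst (act i.1 i.2) w = sliceFst (∑ i ∈ S, act i.1 i.2) w := by
          intro w S
          classical
          induction S using Finset.induction_on with
          | empty => simp [sliceFst]
          | insert i S hi ih => rw [Finset.sum_insert hi, Finset.sum_insert hi, sliceFst_add, ih]
        simp only [TensorProduct.map_tmul, LinearMap.comp_apply, ← TensorProduct.sum_tmul, h6, hS]
        simp [sliceFst]
    rw [h5, map_zero]
  have h7 : ∀ i : A × Module.Dual ℂ A, preSlice V (i.1 ⊗ₜ i.2) x =
      sliceSnd Q.φ (TensorProduct.map (G i) LinearMap.id (Q.T₁ (d ⊗ₜ i.1))) := fun i => by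
    have h8 : ∀ z : A ⊗[ℂ] A, sliceSnd Q.φ (TensorProduct.map (G i) LinearMap.id z) =
        G i (sliceSnd Q.φ z) := fun z => by
      induction z with
      | zero => simp
      | add z z' hz hz' => simp only [map_add, hz, hz']
      | tmul p q => simp
    rw [h8, ← Q.left_sndSlice, Q.left_invariant, left_smul, left_one, hd, one_smul]
    rfl
  rw [map_sum, LinearMap.sum_apply, Finset.sum_congr rfl fun i _ => h7 i, ← map_sum]
  change sliceSnd Q.φ N = _
  rw [hN, map_zero, LinearMap.zero_apply]

theorem leftSlice_act (Q : AlgebraicQuantumGroup A) (V : Multiplier (A ⊗[ℂ] B)) (a : A)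
    (ω : Module.Dual ℂ A) (x : B) :
    leftSlice V ⟨act a ω, act_mem_circ a ω⟩ x = sliceFst ω (left V (a ⊗ₜ x)) := by
  have h := preSlice_eq_zero Q V (linearSection actMap actMap_range
    ⟨act a ω, act_mem_circ a ω⟩ - a ⊗ₜ ω) (by
      rw [map_sub, linearSection_spec, sub_eq_zero]
      rfl)
  rw [map_sub, sub_eq_zero] at h
  exact LinearMap.congr_fun h x

end leftSlice

namespace AlgebraicQuantumGroup

variable (Q : AlgebraicQuantumGroup A)

theorem dual_le_circ : Q.dual ≤ circ A := by
  rintro _ ⟨a, rfl⟩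
  exact act_mem_circ a Q.φ

variable {B : Type*} [NonUnitalRing B] [Module ℂ B] [IsScalarTower ℂ B B] [SMulCommClass ℂ B B]
  [IsNondegenerate B]

/-- `π` is the homomorphism `π_V : Â → M(B)`, that is `π(ω) = (ω ⊙ ι)(V)` for all `ω ∈ Â`. -/
def IsInducedHom (V : Multiplier (A ⊗[ℂ] B)) (π : Q.dual →ₙₐ[ℂ] Multiplier B) : Prop :=
  ∀ ω : Q.dual, left (π ω) = leftSlice V ⟨ω, Q.dual_le_circ ω.2⟩

end AlgebraicQuantumGroup

end QuantumGroup

end AlgQG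

/-! The proof rests on one consequence of (Δ ⊙ ι)(V) = V₁₃V₂₃. Put π(aφ)x = (φ ⊙ ι)(V(a ⊗ x)).
Applying the corepresentation identity to Δ(p)(q ⊗ 1) ⊗ x and slicing the second leg by φ, left
invariance gives (*) Σ V(aᵢ ⊗ π(cᵢφ)x) = q ⊗ π(pφ)x whenever Δ(p)(q ⊗ 1) = Σ aᵢ ⊗ cᵢ, which is
`left_lTensor_T₁`. Slicing (*) by φ once more shows that π is multiplicative. By (*), V(A ⊗ B)
contains A ⊗ π(Â)B, while (φ ⊙ ι)(V(A ⊗ B)) lies in π(Â)B; so V(A ⊗ B) = A ⊗ B exactly when π(Â)B =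
B. Left multiplication by U sends Σ aᵢ ⊗ cᵢφ to q ⊗ pφ (`universalLeft`), so (*) also says (ι ⊙
π)(U) = V.

The opposite side needs right multiplication by π(aφ). For this one uses a right Haar functional ψ
and, for each a, some b with φ(ma) = ψ(bm) for all multipliers m, every b occurring in this way
(`exists_right_haar_modularPairs`). Then xπ(aφ) = (ψ ⊙ ι)((b ⊗ x)V) (`mul_sliceFst_left`), and the
mirror image of (*) is `right_lTensor_T₄`. Rewriting aφ as ψ(b ·) also yields right multiplication
by U.

Counit, antipode and ψ are not part of the data and are built from φ. Coassociativity gives a counit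
ε (`exists_counit`). Left invariance inverts x ⊗ c ↦ Δ(x)(1 ⊗ c) explicitly (`mSlice_P₁`), which
gives a surjective antimultiplicative S with ψ = φ ∘ S right invariant (`exists_antipode`). The same
construction for the co-opposite comultiplication, starting from ψ, gives a second such map R, and S
and R together relate φ(x ·) to ψ(· x) (`exists_right_invariant`). Bijectivity of S and uniqueness
of Haar functionals are not used.

Invertibility enters only at the end: over a non-degenerate algebra, a multiplier acting
surjectively on both sides also acts injectively, and the two inverse maps form a multiplier. -/

namespace AlgQG

/-! ### Slice maps and their compatibility with linear maps. -/

section TensorSlices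

variable {M N V W : Type*} [AddCommGroup M] [Module ℂ M] [AddCommGroup N] [Module ℂ N]
  [AddCommGroup V] [Module ℂ V] [AddCommGroup W] [Module ℂ W]

theorem sliceFst_lTensor (ω : Module.Dual ℂ M) (f : V →ₗ[ℂ] W) (z : M ⊗[ℂ] V) :
    sliceFst ω (LinearMap.lTensor M f z) = f (sliceFst ω z) := by
  induction z with
  | zero => simp
  | tmul m v => simp
  | add x y hx hy => simp only [map_add, hx, hy]

theorem sliceSnd_rTensor (ω : Module.Dual ℂ M) (f : V →ₗ[ℂ] W) (z : V ⊗[ℂ] M) :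
    sliceSnd ω (LinearMap.rTensor M f z) = f (sliceSnd ω z) := by
  induction z with
  | zero => simp
  | tmul m v => simp
  | add x y hx hy => simp only [map_add, hx, hy]

theorem sliceSnd_lTensor (ω : Module.Dual ℂ W) (f : V →ₗ[ℂ] W) (z : M ⊗[ℂ] V) :
    sliceSnd ω (LinearMap.lTensor M f z) = sliceSnd (ω ∘ₗ f) z := by
  induction z with
  | zero => simp
  | tmul m v => simp
  | add x y hx hy => simp only [map_add, hx, hy]

theorem sliceFst_rTensor (ω : Module.Dual ℂ W) (f : V →ₗ[ℂ] W) (z : V ⊗[ℂ] M) :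
    sliceFst ω (LinearMap.rTensor M f z) = sliceFst (ω ∘ₗ f) z := by
  induction z with
  | zero => simp
  | tmul m v => simp
  | add x y hx hy => simp only [map_add, hx, hy]

theorem sliceSnd_comm (ω : Module.Dual ℂ M) (z : M ⊗[ℂ] V) :
    sliceSnd ω (TensorProduct.comm ℂ M V z) = sliceFst ω z := by
  induction z with
  | zero => simp
  | tmul m v => simp
  | add x y hx hy => simp only [map_add, hx, hy]

theorem sliceFst_comm (ω : Module.Dual ℂ V) (z : M ⊗[ℂ] V) :
    sliceFst ω (TensorProduct.comm ℂ M V z) = sliceSnd ω z := by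
  induction z with
  | zero => simp
  | tmul m v => simp
  | add x y hx hy => simp only [map_add, hx, hy]

theorem apply_sliceFst (ω : Module.Dual ℂ M) (η : Module.Dual ℂ V) (z : M ⊗[ℂ] V) :
    η (sliceFst ω z) = ω (sliceSnd η z) := by
  induction z with
  | zero => simp
  | tmul m v => simp [mul_comm]
  | add x y hx hy => simp only [map_add, hx, hy]

theorem sliceSnd_assoc_symm (ω : Module.Dual ℂ W) (m : M) (z : V ⊗[ℂ] W) :
    sliceSnd ω ((TensorProduct.assoc ℂ M V W).symm (m ⊗ₜ z)) = m ⊗ₜ sliceSnd ω z := by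
  induction z with
  | zero => simp
  | tmul m v => simp
  | add x y hx hy => simp only [map_add, TensorProduct.tmul_add, hx, hy]

/-- Functionals on M separate M ⊗ V, and slicing commutes with ι ⊗ fᵢ. This is how auxiliary
covering factors are cancelled throughout. -/
theorem eq_of_lTensor {ι : Sort*} (f : ι → V →ₗ[ℂ] W) (hf : ∀ v, (∀ i, f i v = 0) → v = 0)
    {y z : M ⊗[ℂ] V} (h : ∀ i, LinearMap.lTensor M (f i) y = LinearMap.lTensor M (f i) z) :
    y = z := by
  rw [← sub_eq_zero]
  refine eq_zero_of_sliceFst _ fun ω => hf _ fun i => ?_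
  rw [← sliceFst_lTensor, map_sub, h, sub_self, map_zero]

theorem eq_of_rTensor {ι : Sort*} (f : ι → V →ₗ[ℂ] W) (hf : ∀ v, (∀ i, f i v = 0) → v = 0)
    {y z : V ⊗[ℂ] M} (h : ∀ i, LinearMap.rTensor M (f i) y = LinearMap.rTensor M (f i) z) :
    y = z := by
  rw [← sub_eq_zero]
  refine eq_zero_of_sliceSnd _ fun ω => hf _ fun i => ?_
  rw [← sliceSnd_rTensor, map_sub, h, sub_self, map_zero]

theorem exists_apply_eq_one {ω : Module.Dual ℂ V} (h : ω ≠ 0) : ∃ v, ω v = 1 := by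
  obtain ⟨d, hd⟩ : ∃ d, ω d ≠ 0 := by
    by_contra! h'
    exact h (LinearMap.ext h')
  exact ⟨(ω d)⁻¹ • d, by simp [hd]⟩

theorem sliceFst_surjective {ω : Module.Dual ℂ V} (h : ω ≠ 0) :
    Function.Surjective (sliceFst (W := W) ω) := fun w => by
  obtain ⟨v, hv⟩ := exists_apply_eq_one h
  exact ⟨v ⊗ₜ w, by simp [hv]⟩

theorem sliceSnd_surjective {ω : Module.Dual ℂ V} (h : ω ≠ 0) :
    Function.Surjective (sliceSnd (V := W) ω) := fun w => by
  obtain ⟨v, hv⟩ := exists_apply_eq_one h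
  exact ⟨w ⊗ₜ v, by simp [hv]⟩

end TensorSlices

/-! ### Cancellation in non-degenerate algebras, also inside one leg of a tensor product. -/

section Cancellation

variable {A : Type*} [NonUnitalRing A] [Module ℂ A] [IsScalarTower ℂ A A] [SMulCommClass ℂ A A]
  [IsNondegenerate A]

theorem eq_of_mul_right {a b : A} (h : ∀ c, a * c = b * c) : a = b := by
  rw [← sub_eq_zero]
  exact IsNondegenerate.eq_zero_of_mul_right _ fun c => by rw [sub_mul, h, sub_self]

theorem eq_of_mul_left {a b : A} (h : ∀ c, c * a = c * b) : a = b := by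
  rw [← sub_eq_zero]
  exact IsNondegenerate.eq_zero_of_mul_left _ fun c => by rw [mul_sub, h, sub_self]

variable {M : Type*} [AddCommGroup M] [Module ℂ M]

theorem eq_of_rTensor_mulLeft {y z : A ⊗[ℂ] M} (h : ∀ a : A,
    LinearMap.rTensor M (LinearMap.mulLeft ℂ a) y = LinearMap.rTensor M (LinearMap.mulLeft ℂ a) z) :
    y = z :=
  eq_of_rTensor (fun a : A => LinearMap.mulLeft ℂ a) IsNondegenerate.eq_zero_of_mul_left h

theorem eq_of_rTensor_mulRight {y z : A ⊗[ℂ] M} (h : ∀ a : A,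
    LinearMap.rTensor M (LinearMap.mulRight ℂ a) y =
      LinearMap.rTensor M (LinearMap.mulRight ℂ a) z) : y = z :=
  eq_of_rTensor (fun a : A => LinearMap.mulRight ℂ a) IsNondegenerate.eq_zero_of_mul_right h

theorem eq_of_lTensor_mulRight {y z : M ⊗[ℂ] A} (h : ∀ a : A,
    LinearMap.lTensor M (LinearMap.mulRight ℂ a) y =
      LinearMap.lTensor M (LinearMap.mulRight ℂ a) z) : y = z :=
  eq_of_lTensor (fun a : A => LinearMap.mulRight ℂ a) IsNondegenerate.eq_zero_of_mul_right h

end Cancellation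

/-! ### Regular multiplier Hopf algebras described by their canonical bijections. -/

section Covering

variable (A : Type*) [NonUnitalRing A] [Module ℂ A] [IsScalarTower ℂ A A] [SMulCommClass ℂ A A]

/-- The four canonical bijections of a regular multiplier Hopf algebra, with the relations between
them that do not refer to multipliers: in Sweedler notation `P₁ (a ⊗ x) = x₁ a ⊗ x₂`,
`P₂ (x ⊗ c) = x₁ ⊗ x₂ c`, `P₃ (a ⊗ x) = a x₁ ⊗ x₂`, `P₄ (x ⊗ c) = x₁ ⊗ c x₂`, and `D x` is the left
multiplication by `Δ(x)`. -/
structure CoveringMaps where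
  P₁ : A ⊗[ℂ] A ≃ₗ[ℂ] A ⊗[ℂ] A
  P₂ : A ⊗[ℂ] A ≃ₗ[ℂ] A ⊗[ℂ] A
  P₃ : A ⊗[ℂ] A ≃ₗ[ℂ] A ⊗[ℂ] A
  P₄ : A ⊗[ℂ] A ≃ₗ[ℂ] A ⊗[ℂ] A
  D : A →ₗ[ℂ] A ⊗[ℂ] A →ₗ[ℂ] A ⊗[ℂ] A
  D_tmul_P₁ : ∀ x b s, D x (b ⊗ₜ s) = LinearMap.lTensor A (LinearMap.mulRight ℂ s) (P₁ (b ⊗ₜ x))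
  D_tmul_P₂ : ∀ x b s, D x (b ⊗ₜ s) = LinearMap.rTensor A (LinearMap.mulRight ℂ b) (P₂ (x ⊗ₜ s))
  D_P₁ : ∀ x a y, D x (P₁ (a ⊗ₜ y)) = P₁ (a ⊗ₜ (x * y))
  D_P₂ : ∀ x y c, D x (P₂ (y ⊗ₜ c)) = P₂ ((x * y) ⊗ₜ c)
  P₃_P₂ : ∀ a x c, LinearMap.lTensor A (LinearMap.mulRight ℂ c) (P₃ (a ⊗ₜ x)) =
    LinearMap.rTensor A (LinearMap.mulLeft ℂ a) (P₂ (x ⊗ₜ c))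
  P₁_P₄ : ∀ a x c, LinearMap.lTensor A (LinearMap.mulLeft ℂ c) (P₁ (a ⊗ₜ x)) =
    LinearMap.rTensor A (LinearMap.mulRight ℂ a) (P₄ (x ⊗ₜ c))
  coassoc₃₂ : ∀ a x c, TensorProduct.assoc ℂ A A A
      (LinearMap.rTensor A (P₃.toLinearMap ∘ₗ TensorProduct.mk ℂ A A a) (P₂ (x ⊗ₜ c))) =
    LinearMap.lTensor A (P₂.toLinearMap ∘ₗ (TensorProduct.mk ℂ A A).flip c) (P₃ (a ⊗ₜ x))
  coassoc₁₄ : ∀ a x c, TensorProduct.assoc ℂ A A A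
      (LinearMap.rTensor A (P₁.toLinearMap ∘ₗ TensorProduct.mk ℂ A A a) (P₄ (x ⊗ₜ c))) =
    LinearMap.lTensor A (P₄.toLinearMap ∘ₗ (TensorProduct.mk ℂ A A).flip c) (P₁ (a ⊗ₜ x))

variable {A}

/-! ### Construction of the counit and the antipode from a left invariant functional. -/

namespace CoveringMaps

variable (C : CoveringMaps A)

/-- The element `(ι ⊙ φ)(Δ(x) (1 ⊗ c))`, as a linear function of `c`. -/
def mSlice (φ : Module.Dual ℂ A) (x : A) : A →ₗ[ℂ] A :=
  sliceSnd φ ∘ₗ C.P₂.toLinearMap ∘ₗ TensorProduct.mk ℂ A A x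

theorem mSlice_apply (φ : Module.Dual ℂ A) (x c : A) :
    C.mSlice φ x c = sliceSnd φ (C.P₂ (x ⊗ₜ c)) := rfl

/-- The candidate for ε(y)c is the product of the two legs of `P₂`⁻¹(y ⊗ c). Coassociativity shows
that for y = (φ ⊙ ι)((a ⊗ 1)Δ(x)) it equals φ(ax)c, a scalar multiple of c, and such y span A. -/
theorem exists_counit {φ : Module.Dual ℂ A} (hφ : φ ≠ 0) :
    ∃ ε : Module.Dual ℂ A, ∀ z, sliceFst ε (C.P₂ z) = LinearMap.mul' ℂ A z := by
  -- For z = x ⊗ c, coassociativity turns the inner expression into ax₁ ⊗ x₂ ⊗ x₃c; undoing `P₂` and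
  -- multiplying leaves ax₁ ⊗ x₂c.
  have h1 : ∀ (a : A) (z : A ⊗[ℂ] A), LinearMap.lTensor A (LinearMap.mul' ℂ A ∘ₗ C.P₂.symm.toLinearMap)
      (TensorProduct.assoc ℂ A A A
        (LinearMap.rTensor A (C.P₃.toLinearMap ∘ₗ TensorProduct.mk ℂ A A a) (C.P₂ z))) =
      LinearMap.rTensor A (LinearMap.mulLeft ℂ a) (C.P₂ z) := fun a z => by
    induction z with
    | zero => simp
    | add y z hy hz => simp only [map_add, hy, hz]
    | tmul p q =>
      rw [C.coassoc₃₂, ← C.P₃_P₂, ← LinearMap.comp_apply, ← LinearMap.lTensor_comp]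
      congr 2
      ext y
      simp
  have h2 : ∀ (t : A ⊗[ℂ] A) (c : A),
      LinearMap.mul' ℂ A (C.P₂.symm (sliceFst φ (C.P₃ t) ⊗ₜ c)) = φ (LinearMap.mul' ℂ A t) • c := by
    intro t c
    induction t with
    | zero => simp
    | add y z hy hz => simp only [map_add, TensorProduct.add_tmul, add_smul, hy, hz]
    | tmul a x =>
      -- Taking z = `P₂`⁻¹(x ⊗ c) makes the right side of `h1` equal to ax ⊗ c.
      have h := congrArg (sliceFst φ) (h1 a (C.P₂.symm (x ⊗ₜ c)))
      simp only [LinearEquiv.apply_symm_apply, sliceFst_lTensor, LinearMap.rTensor_tmul,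
        LinearMap.comp_apply, TensorProduct.mk_apply, LinearEquiv.coe_coe, sliceFst_tmul,
        LinearMap.mulLeft_apply] at h
      rw [LinearMap.mul'_apply, ← h]
      congr 2
      generalize C.P₃ (a ⊗ₜ x) = w
      induction w with
      | zero => simp
      | add y z hy hz => simp only [map_add, TensorProduct.add_tmul, hy, hz]
      | tmul u v => simp [TensorProduct.smul_tmul']
  have h3 : LinearMap.range (sliceFst φ ∘ₗ C.P₃.toLinearMap) = ⊤ :=
    LinearMap.range_eq_top.2 ((sliceFst_surjective hφ).comp C.P₃.surjective)
  -- By `h2` the value of ε does not depend on the chosen preimage; a linear section only serves to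
  -- make ε linear.
  refine ⟨φ ∘ₗ LinearMap.mul' ℂ A ∘ₗ linearSection _ h3, fun z => ?_⟩
  obtain ⟨z, rfl⟩ := C.P₂.symm.surjective z
  rw [LinearEquiv.apply_symm_apply]
  induction z with
  | zero => simp
  | add y z hy hz => simp only [map_add, hy, hz]
  | tmul y c =>
    have := h2 (linearSection _ h3 y) c
    rw [show sliceFst φ (C.P₃ (linearSection _ h3 y)) = y from linearSection_spec _ h3 y] at this
    simp [this]

variable [IsNondegenerate A]

/-- An explicit inverse of `P₂`. In Sweedler notation the left side is x₁ ⊗ x₂c₁d φ(x₃c₂), and left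
invariance applied to x₂c collapses it to x₁φ(x₂c) ⊗ d. -/
theorem mSlice_P₁ {φ : Module.Dual ℂ A} (hφ : ∀ d c, sliceSnd φ (C.P₁ (d ⊗ₜ c)) = φ c • d)
    (x c d : A) : C.P₂ (TensorProduct.comm ℂ A A (LinearMap.lTensor A (C.mSlice φ x)
      (C.P₁ (d ⊗ₜ c)))) = C.mSlice φ x c ⊗ₜ d := by
  -- For z = f ⊗ g both sides are ax₁ ⊗ x₂f φ(x₃g). The factor a covers the first leg, so that
  -- coassociativity is available in the form `coassoc₃₂`.
  have h1 : ∀ (a : A) (z : A ⊗[ℂ] A), LinearMap.rTensor A (LinearMap.mulLeft ℂ a)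
      (C.P₂ (TensorProduct.comm ℂ A A (LinearMap.lTensor A (C.mSlice φ x) z))) =
      LinearMap.lTensor A (sliceSnd φ ∘ₗ C.D.flip z) (C.P₃ (a ⊗ₜ x)) := fun a z => by
    induction z with
    | zero => simp
    | add y z hy hz =>
      simp only [map_add, LinearMap.comp_add, LinearMap.lTensor_add, LinearMap.add_apply, hy, hz]
    | tmul f g =>
      have h2 : ∀ w : A ⊗[ℂ] A, LinearMap.lTensor A (LinearMap.mulRight ℂ f) (sliceSnd φ
          (LinearMap.rTensor A (C.P₃.toLinearMap ∘ₗ TensorProduct.mk ℂ A A a) w)) =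
          LinearMap.rTensor A (LinearMap.mulLeft ℂ a) (C.P₂ (sliceSnd φ w ⊗ₜ f)) := fun w => by
        induction w with
        | zero => simp
        | add y z hy hz => simp only [map_add, TensorProduct.add_tmul, hy, hz]
        | tmul u v => simp [← TensorProduct.smul_tmul', C.P₃_P₂]
      have h3 := congrArg (fun w => LinearMap.lTensor A (LinearMap.mulRight ℂ f)
        (sliceSnd φ ((TensorProduct.assoc ℂ A A A).symm w))) (C.coassoc₃₂ a x g)
      simp only [LinearEquiv.symm_apply_apply, h2] at h3
      rw [LinearMap.lTensor_tmul, TensorProduct.comm_tmul, mSlice_apply, h3]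
      generalize C.P₃ (a ⊗ₜ x) = w
      induction w with
      | zero => simp
      | add y z hy hz => simp only [map_add, hy, hz]
      | tmul u v => simp [sliceSnd_assoc_symm, C.D_tmul_P₂, sliceSnd_rTensor]
  refine eq_of_rTensor_mulLeft fun a => ?_
  have h4 : a * C.mSlice φ x c = sliceSnd φ (LinearMap.lTensor A (LinearMap.mulRight ℂ c)
      (C.P₃ (a ⊗ₜ x))) := by
    rw [C.P₃_P₂, sliceSnd_rTensor]
    rfl
  rw [h1, LinearMap.rTensor_tmul, LinearMap.mulLeft_apply, h4]
  generalize C.P₃ (a ⊗ₜ x) = w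
  induction w with
  | zero => simp
  | add y z hy hz => simp only [map_add, TensorProduct.add_tmul, hy, hz]
  | tmul u v => simp [C.D_P₁, hφ, TensorProduct.smul_tmul']

theorem apply_mSlice {ε : Module.Dual ℂ A} (hε : ∀ z, sliceFst ε (C.P₂ z) = LinearMap.mul' ℂ A z)
    (φ : Module.Dual ℂ A) (x c : A) : ε (C.mSlice φ x c) = φ (x * c) := by
  rw [mSlice_apply, ← apply_sliceFst, hε, LinearMap.mul'_apply]

/-- Because Δ(r)Δ(u) = Δ(ru), multiplying `P₂`⁻¹(b ⊗ s) by r on the first leg produces, under `P₂`,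
the element Δ(r)(b ⊗ s). Read backwards in `P₂_symm_mul`, this is the source of the
antimultiplicativity of the antipode. -/
theorem P₂_mul (b : A) (t : A ⊗[ℂ] A) : C.P₂ (LinearMap.rTensor A (LinearMap.mul' ℂ A)
    ((TensorProduct.assoc ℂ A A A).symm (LinearMap.lTensor A
      (C.P₂.symm.toLinearMap ∘ₗ TensorProduct.mk ℂ A A b) t))) =
    LinearMap.rTensor A (LinearMap.mulRight ℂ b) (C.P₂ t) := by
  induction t with
  | zero => simp
  | add y z hy hz => simp only [map_add, hy, hz]
  | tmul r s =>
    rw [← C.D_tmul_P₂, LinearMap.lTensor_tmul]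
    obtain ⟨z, hz⟩ := C.P₂.surjective (b ⊗ₜ s)
    simp only [LinearMap.comp_apply, TensorProduct.mk_apply, LinearEquiv.coe_coe, ← hz,
      LinearEquiv.symm_apply_apply]
    clear hz
    induction z with
    | zero => simp
    | add y z hy hz => simp only [map_add, TensorProduct.tmul_add, hy, hz]
    | tmul u v => simp [C.D_P₂]

theorem P₂_symm_mul (a b c : A) : C.P₂.symm ((a * b) ⊗ₜ c) =
    LinearMap.rTensor A (LinearMap.mul' ℂ A)
    ((TensorProduct.assoc ℂ A A A).symm (LinearMap.lTensor A
      (C.P₂.symm.toLinearMap ∘ₗ TensorProduct.mk ℂ A A b) (C.P₂.symm (a ⊗ₜ c)))) := by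
  rw [LinearEquiv.symm_apply_eq, C.P₂_mul, LinearEquiv.apply_symm_apply]
  simp

section Counit

variable {C} {ε : Module.Dual ℂ A} (hε : ∀ z, sliceFst ε (C.P₂ z) = LinearMap.mul' ℂ A z)
include hε

/-- Multiplying the legs of `P₂`⁻¹ gives ε ⊙ ι, so multiplying out `P₂_symm_mul` yields ε(ab)d =
ε(a)ε(b)d; a non-zero d is then cancelled. -/
theorem counit_mul (hA : ∃ d : A, d ≠ 0) (a b : A) : ε (a * b) = ε a * ε b := by
  obtain ⟨d, hd⟩ := hA
  refine smul_left_injective ℂ hd ?_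
  have h1 : ∀ z : A ⊗[ℂ] A, LinearMap.mul' ℂ A (C.P₂.symm z) = sliceFst ε z := fun z => by
    rw [← hε, LinearEquiv.apply_symm_apply]
  have h2 : ∀ t : A ⊗[ℂ] A, LinearMap.mul' ℂ A (LinearMap.rTensor A (LinearMap.mul' ℂ A)
    ((TensorProduct.assoc ℂ A A A).symm (LinearMap.lTensor A
      (C.P₂.symm.toLinearMap ∘ₗ TensorProduct.mk ℂ A A b) t))) =
      ε b • LinearMap.mul' ℂ A t := fun t => by
    induction t with
    | zero => simp
    | add y z hy hz => simp only [map_add, smul_add, hy, hz]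
    | tmul r s =>
      have h3 : ∀ z : A ⊗[ℂ] A, LinearMap.mul' ℂ A (LinearMap.rTensor A (LinearMap.mul' ℂ A)
          ((TensorProduct.assoc ℂ A A A).symm (r ⊗ₜ z))) = r * LinearMap.mul' ℂ A z := fun z => by
        induction z with
        | zero => simp
        | add y z hy hz => simp only [map_add, TensorProduct.tmul_add, mul_add, hy, hz]
        | tmul u v => simp [mul_assoc]
      simp [h3, h1, mul_smul_comm]
  have := h2 (C.P₂.symm (a ⊗ₜ d))
  rw [← P₂_symm_mul, h1, h1] at this
  simpa [smul_smul, mul_comm] using this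

/-- With S(z)d = (ε ⊙ ι)(`P₂`⁻¹(z ⊗ d)), this reads S(ab)c = S(b)S(a)c. -/
theorem sliceFst_P₂_symm_mul (hA : ∃ d : A, d ≠ 0) (a b c : A) :
    sliceFst ε (C.P₂.symm ((a * b) ⊗ₜ c)) =
      sliceFst ε (C.P₂.symm (b ⊗ₜ sliceFst ε (C.P₂.symm (a ⊗ₜ c)))) := by
  rw [P₂_symm_mul]
  generalize C.P₂.symm (a ⊗ₜ c) = t
  induction t with
  | zero => simp
  | add y z hy hz => simp only [map_add, TensorProduct.tmul_add, hy, hz]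
  | tmul r s =>
    simp only [LinearMap.lTensor_tmul, LinearMap.comp_apply, TensorProduct.mk_apply,
      LinearEquiv.coe_coe, sliceFst_tmul, TensorProduct.tmul_smul, map_smul]
    generalize C.P₂.symm (b ⊗ₜ s) = z
    induction z with
    | zero => simp
    | add y z hy hz => simp only [map_add, TensorProduct.tmul_add, smul_add, hy, hz]
    | tmul u v => simp [counit_mul hε hA, smul_smul]

/-- The explicit inverse in `mSlice_P₁` evaluates S on the elements (ι ⊙ φ)(Δ(x)(1 ⊗ c)), because ε
maps these to φ(xc). -/
theorem sliceFst_P₂_symm_mSlice {φ : Module.Dual ℂ A}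
    (hφ : ∀ d c, sliceSnd φ (C.P₁ (d ⊗ₜ c)) = φ c • d) (x c d : A) :
    sliceFst ε (C.P₂.symm (C.mSlice φ x c ⊗ₜ d)) = sliceSnd φ (C.P₄ (c ⊗ₜ x)) * d := by
  rw [← C.mSlice_P₁ hφ, LinearEquiv.symm_apply_apply]
  have h1 : sliceSnd φ (C.P₄ (c ⊗ₜ x)) * d =
      sliceSnd φ (LinearMap.lTensor A (LinearMap.mulLeft ℂ x) (C.P₁ (d ⊗ₜ c))) := by
    rw [C.P₁_P₄, sliceSnd_rTensor, LinearMap.mulRight_apply]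
  rw [h1, sliceFst_comm]
  generalize C.P₁ (d ⊗ₜ c) = z
  induction z with
  | zero => simp
  | add y z hy hz => simp only [map_add, hy, hz]
  | tmul u v => simp [C.apply_mSlice hε]

end Counit

/-- The functional c ↦ φ(c₁)φ(xc₂) is again left invariant: in c₁d φ(c₂)φ(xc₃), left invariance of φ
acts on the first two legs. Once S exists, this functional is c ↦ φ(S((ι ⊙ φ)(Δ(x)(1 ⊗ c)))). -/
theorem sliceSnd_P₄_invariant {φ : Module.Dual ℂ A}
    (hφ : ∀ d c, sliceSnd φ (C.P₁ (d ⊗ₜ c)) = φ c • d) (x c d : A) :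
    sliceSnd (φ ∘ₗ sliceSnd φ ∘ₗ C.P₄.toLinearMap ∘ₗ (TensorProduct.mk ℂ A A).flip x)
      (C.P₁ (d ⊗ₜ c)) = φ (sliceSnd φ (C.P₄ (c ⊗ₜ x))) • d := by
  have h := congrArg (sliceSnd (φ ∘ₗ sliceSnd φ)) (C.coassoc₁₄ d c x)
  rw [sliceSnd_lTensor, LinearMap.comp_assoc] at h
  rw [← h]
  generalize C.P₄ (c ⊗ₜ x) = z
  induction z with
  | zero => simp
  | add y z hy hz => simp only [map_add, add_smul, hy, hz]
  | tmul u v =>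
    have h1 : ∀ w : A ⊗[ℂ] A, sliceSnd (φ ∘ₗ sliceSnd φ) (TensorProduct.assoc ℂ A A A (w ⊗ₜ v)) =
        φ v • sliceSnd φ w := fun w => by
      induction w with
      | zero => simp
      | add y z hy hz => simp only [map_add, TensorProduct.add_tmul, smul_add, hy, hz]
      | tmul u v => simp [smul_smul]
    simp [h1, hφ, smul_smul]

/-- The antipode, determined by `S((ι ⊙ φ)(Δ(x) (1 ⊗ c))) = (ι ⊙ φ)((1 ⊗ x) Δ(c))`. -/
theorem exists_antipode {φ : Module.Dual ℂ A} (hφ0 : φ ≠ 0)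
    (hφ : ∀ d c, sliceSnd φ (C.P₁ (d ⊗ₜ c)) = φ c • d) :
    ∃ S : A →ₗ[ℂ] A, Function.Surjective S ∧ (∀ a b, S (a * b) = S b * S a) ∧
      (∀ x c, S (sliceSnd φ (C.P₂ (x ⊗ₜ c))) = sliceSnd φ (C.P₄ (c ⊗ₜ x))) ∧
      ∀ z d, sliceFst (φ ∘ₗ S) (C.P₂ (z ⊗ₜ d)) = φ (S z) • d := by
  obtain ⟨ε, hε⟩ := C.exists_counit hφ0
  have hA : ∃ d : A, d ≠ 0 := by
    obtain ⟨d, hd⟩ := exists_apply_eq_one hφ0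
    exact ⟨d, fun h => by simp [h] at hd⟩
  have hm : LinearMap.range (sliceSnd φ ∘ₗ C.P₂.toLinearMap) = ⊤ :=
    LinearMap.range_eq_top.2 ((sliceSnd_surjective hφ0).comp C.P₂.surjective)
  let T : A ⊗[ℂ] A →ₗ[ℂ] A :=
    sliceSnd φ ∘ₗ C.P₄.toLinearMap ∘ₗ (TensorProduct.comm ℂ A A).toLinearMap
  have hT : Function.Surjective T := (sliceSnd_surjective hφ0).comp
    (C.P₄.surjective.comp (TensorProduct.comm ℂ A A).surjective)
  have h1 : ∀ (t : A ⊗[ℂ] A) (d : A),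
      sliceFst ε (C.P₂.symm (sliceSnd φ (C.P₂ t) ⊗ₜ d)) = T t * d := fun t d => by
    induction t with
    | zero => simp
    | add y z hy hz => simp only [map_add, TensorProduct.add_tmul, add_mul, hy, hz]
    | tmul x c => exact sliceFst_P₂_symm_mSlice hε hφ x c d
  -- The section picks an arbitrary preimage; `h1` shows that the result depends only on z, since
  -- S(z)d = (ε ⊙ ι)(`P₂`⁻¹(z ⊗ d)).
  let S : A →ₗ[ℂ] A := T ∘ₗ linearSection _ hm
  have h2 : ∀ z d, S z * d = sliceFst ε (C.P₂.symm (z ⊗ₜ d)) := fun z d => by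
    rw [LinearMap.comp_apply, ← h1]
    congr 3
    exact linearSection_spec _ hm z
  have h3 : ∀ t, S (sliceSnd φ (C.P₂ t)) = T t := fun t =>
    eq_of_mul_right fun d => by rw [h2, h1]
  have h4 : ∀ x c, S (sliceSnd φ (C.P₂ (x ⊗ₜ c))) = sliceSnd φ (C.P₄ (c ⊗ₜ x)) :=
    fun x c => h3 _
  refine ⟨S, fun z => ?_, fun a b => eq_of_mul_right fun d => ?_, h4, fun z d => ?_⟩
  · obtain ⟨t, rfl⟩ := hT z
    exact ⟨_, h3 t⟩
  · rw [h2, mul_assoc, h2, h2, sliceFst_P₂_symm_mul hε hA]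
  · have h5 : ∀ w, sliceFst (φ ∘ₗ S) (C.P₂.symm w) = sliceFst (φ ∘ₗ S) w := fun w => by
      induction w with
      | zero => simp
      | add y z hy hz => simp only [map_add, hy, hz]
      | tmul z d =>
        obtain ⟨t, rfl⟩ := LinearMap.range_eq_top.1 hm z
        induction t with
        | zero => simp
        | add y z hy hz => simp only [map_add, TensorProduct.add_tmul, hy, hz]
        | tmul x c =>
          have h6 : (φ ∘ₗ S) ∘ₗ C.mSlice φ x = φ ∘ₗ sliceSnd φ ∘ₗ C.P₄.toLinearMap ∘ₗ
              (TensorProduct.mk ℂ A A).flip x := by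
            ext c
            simp [mSlice_apply, h4]
          change sliceFst (φ ∘ₗ S) (C.P₂.symm (C.mSlice φ x c ⊗ₜ d)) =
            sliceFst (φ ∘ₗ S) (C.mSlice φ x c ⊗ₜ d)
          rw [← C.mSlice_P₁ hφ, LinearEquiv.symm_apply_apply, sliceFst_comm, sliceSnd_lTensor, h6,
            C.sliceSnd_P₄_invariant hφ, C.mSlice_P₁ hφ, sliceFst_tmul, LinearMap.comp_apply,
            mSlice_apply, h4]
    rw [← h5, LinearEquiv.symm_apply_apply, sliceFst_tmul, LinearMap.comp_apply]

/-! ### The co-opposite comultiplication, obtained by conjugating with the flip. -/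

theorem comm_lTensor_mulLeft (a : A) (z : A ⊗[ℂ] A) : TensorProduct.comm ℂ A A
    (LinearMap.lTensor A (LinearMap.mulLeft ℂ a) z) =
    LinearMap.rTensor A (LinearMap.mulLeft ℂ a) (TensorProduct.comm ℂ A A z) := by
  induction z with
  | zero => simp
  | add y z hy hz => simp only [map_add, hy, hz]
  | tmul u v => simp

theorem comm_rTensor_mulLeft (a : A) (z : A ⊗[ℂ] A) : TensorProduct.comm ℂ A A
    (LinearMap.rTensor A (LinearMap.mulLeft ℂ a) z) =
    LinearMap.lTensor A (LinearMap.mulLeft ℂ a) (TensorProduct.comm ℂ A A z) := by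
  induction z with
  | zero => simp
  | add y z hy hz => simp only [map_add, hy, hz]
  | tmul u v => simp

theorem comm_lTensor_mulRight (a : A) (z : A ⊗[ℂ] A) : TensorProduct.comm ℂ A A
    (LinearMap.lTensor A (LinearMap.mulRight ℂ a) z) =
    LinearMap.rTensor A (LinearMap.mulRight ℂ a) (TensorProduct.comm ℂ A A z) := by
  induction z with
  | zero => simp
  | add y z hy hz => simp only [map_add, hy, hz]
  | tmul u v => simp

theorem comm_rTensor_mulRight (a : A) (z : A ⊗[ℂ] A) : TensorProduct.comm ℂ A A
    (LinearMap.rTensor A (LinearMap.mulRight ℂ a) z) =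
    LinearMap.lTensor A (LinearMap.mulRight ℂ a) (TensorProduct.comm ℂ A A z) := by
  induction z with
  | zero => simp
  | add y z hy hz => simp only [map_add, hy, hz]
  | tmul u v => simp

/-- Conjugation of an automorphism of `A ⊗ A` by the flip. -/
def flipConj (P : A ⊗[ℂ] A ≃ₗ[ℂ] A ⊗[ℂ] A) : A ⊗[ℂ] A ≃ₗ[ℂ] A ⊗[ℂ] A :=
  (TensorProduct.comm ℂ A A).trans (P.trans (TensorProduct.comm ℂ A A))

@[simp] theorem flipConj_tmul (P : A ⊗[ℂ] A ≃ₗ[ℂ] A ⊗[ℂ] A) (a b : A) :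
    flipConj P (a ⊗ₜ b) = TensorProduct.comm ℂ A A (P (b ⊗ₜ a)) := rfl

/-- The reversal `a ⊗ b ⊗ c ↦ c ⊗ b ⊗ a`. -/
def tensorReverse : A ⊗[ℂ] (A ⊗[ℂ] A) →ₗ[ℂ] A ⊗[ℂ] (A ⊗[ℂ] A) :=
  (TensorProduct.assoc ℂ A A A).toLinearMap ∘ₗ (TensorProduct.comm ℂ A (A ⊗[ℂ] A)).toLinearMap ∘ₗ
    LinearMap.lTensor A (TensorProduct.comm ℂ A A).toLinearMap

theorem assoc_comm_tmul (w : A ⊗[ℂ] A) (u : A) :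
    TensorProduct.assoc ℂ A A A (TensorProduct.comm ℂ A A w ⊗ₜ u) = tensorReverse (u ⊗ₜ w) := by
  simp [tensorReverse]

theorem tmul_comm_eq (w : A ⊗[ℂ] A) (u : A) :
    u ⊗ₜ TensorProduct.comm ℂ A A w =
      tensorReverse (TensorProduct.assoc ℂ A A A (w ⊗ₜ[ℂ] u)) := by
  induction w with
  | zero => simp
  | add y z hy hz => simp only [map_add, TensorProduct.tmul_add, TensorProduct.add_tmul, hy, hz]
  | tmul u v => simp [tensorReverse]

theorem coassoc_flipConj {P R : A ⊗[ℂ] A ≃ₗ[ℂ] A ⊗[ℂ] A}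
    (h : ∀ a x c, TensorProduct.assoc ℂ A A A
      (LinearMap.rTensor A (P.toLinearMap ∘ₗ TensorProduct.mk ℂ A A a) (R (x ⊗ₜ c))) =
    LinearMap.lTensor A (R.toLinearMap ∘ₗ (TensorProduct.mk ℂ A A).flip c) (P (a ⊗ₜ x)))
    (a x c : A) : TensorProduct.assoc ℂ A A A
      (LinearMap.rTensor A ((flipConj R).toLinearMap ∘ₗ TensorProduct.mk ℂ A A a)
        (flipConj P (x ⊗ₜ c))) =
    LinearMap.lTensor A ((flipConj P).toLinearMap ∘ₗ (TensorProduct.mk ℂ A A).flip c)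
      (flipConj R (a ⊗ₜ x)) := by
  have h1 : ∀ z : A ⊗[ℂ] A, TensorProduct.assoc ℂ A A A
      (LinearMap.rTensor A ((flipConj R).toLinearMap ∘ₗ TensorProduct.mk ℂ A A a)
        (TensorProduct.comm ℂ A A z)) =
      tensorReverse (LinearMap.lTensor A (R.toLinearMap ∘ₗ (TensorProduct.mk ℂ A A).flip a) z) :=
    fun z => by
      induction z with
      | zero => simp
      | add y z hy hz => simp only [map_add, hy, hz]
      | tmul u v => simp [assoc_comm_tmul]
  have h2 : ∀ z : A ⊗[ℂ] A, LinearMap.lTensor A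
      ((flipConj P).toLinearMap ∘ₗ (TensorProduct.mk ℂ A A).flip c) (TensorProduct.comm ℂ A A z) =
      tensorReverse (TensorProduct.assoc ℂ A A A
        (LinearMap.rTensor A (P.toLinearMap ∘ₗ TensorProduct.mk ℂ A A c) z)) :=
    fun z => by
      induction z with
      | zero => simp
      | add y z hy hz => simp only [map_add, hy, hz]
      | tmul u v => simp [tmul_comm_eq]
  rw [flipConj_tmul, flipConj_tmul, h1, h2, h]

/-- The covering maps of the co-opposite comultiplication. -/
def cop : CoveringMaps A where
  P₁ := flipConj C.P₂
  P₂ := flipConj C.P₁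
  P₃ := flipConj C.P₄
  P₄ := flipConj C.P₃
  D := (C.D.compr₂ (TensorProduct.comm ℂ A A).toLinearMap).compl₂
    (TensorProduct.comm ℂ A A).toLinearMap
  D_tmul_P₁ x b s := by simp [C.D_tmul_P₂, comm_rTensor_mulRight]
  D_tmul_P₂ x b s := by simp [C.D_tmul_P₁, comm_lTensor_mulRight]
  D_P₁ x a y := by simp [C.D_P₂]
  D_P₂ x a y := by simp [C.D_P₁]
  P₃_P₂ a x c := by
    simp only [flipConj_tmul, ← comm_lTensor_mulLeft, ← comm_rTensor_mulRight, C.P₁_P₄]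
  P₁_P₄ a x c := by
    simp only [flipConj_tmul, ← comm_rTensor_mulLeft, ← comm_lTensor_mulRight, C.P₃_P₂]
  coassoc₃₂ := coassoc_flipConj C.coassoc₁₄
  coassoc₁₄ := coassoc_flipConj C.coassoc₃₂

/-- With ψ = φ ∘ S left invariant for the co-opposite structure, the antipode construction applies
again and gives R with R(ψ(a₁x)a₂) = ψ(ax₁)x₂. Both ψ(p(t)x) and φ(x q(t)) then reduce to
ψ(ax₁)φ(x₂R(c)) for t = a ⊗ c. -/
theorem exists_right_invariant {φ : Module.Dual ℂ A} (hφ0 : φ ≠ 0)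
    (hφ : ∀ d c, sliceSnd φ (C.P₁ (d ⊗ₜ c)) = φ c • d) :
    ∃ ψ : Module.Dual ℂ A, ψ ≠ 0 ∧ (∀ z d, sliceFst ψ (C.P₂ (z ⊗ₜ d)) = ψ z • d) ∧
      ∃ p q : A ⊗[ℂ] A →ₗ[ℂ] A, Function.Surjective p ∧ Function.Surjective q ∧
        ∀ t x, ψ (p t * x) = φ (x * q t) := by
  obtain ⟨S, hS, hSmul, hSm, hSψ⟩ := C.exists_antipode hφ0 hφ
  have comp_ne : ∀ (T : A →ₗ[ℂ] A), Function.Surjective T → φ ∘ₗ T ≠ 0 := fun T hT h => by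
    obtain ⟨v, hv⟩ := exists_apply_eq_one hφ0
    obtain ⟨w, rfl⟩ := hT v
    exact one_ne_zero (hv.symm.trans (LinearMap.congr_fun h w))
  obtain ⟨R, hR, hRmul, hRm, -⟩ := C.cop.exists_antipode (φ := φ ∘ₗ S) (comp_ne S hS)
    (fun d c => by
      rw [show C.cop.P₁ = flipConj C.P₂ from rfl, flipConj_tmul, sliceSnd_comm, hSψ]
      rfl)
  have hRm' : ∀ a x, R (sliceFst (φ ∘ₗ S) (C.P₁ (x ⊗ₜ a))) =
      sliceFst (φ ∘ₗ S) (C.P₃ (a ⊗ₜ x)) := fun a x => by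
    have := hRm a x
    rwa [show C.cop.P₂ = flipConj C.P₁ from rfl, show C.cop.P₄ = flipConj C.P₃ from rfl,
      flipConj_tmul, flipConj_tmul, sliceSnd_comm, sliceSnd_comm] at this
  -- Here p(a ⊗ c) = a₁φ(R(ca₂)) and q(a ⊗ c) = φ(r₁S(a))r₂ with r = R(c). Both are onto as
  -- composites of surjections, which uses surjectivity of S and R.
  refine ⟨φ ∘ₗ S, comp_ne S hS, hSψ, sliceSnd (φ ∘ₗ R) ∘ₗ C.P₄.toLinearMap,
    sliceFst φ ∘ₗ C.P₁.toLinearMap ∘ₗ TensorProduct.map S R,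
    (sliceSnd_surjective (comp_ne R hR)).comp C.P₄.surjective,
    (sliceFst_surjective hφ0).comp (C.P₁.surjective.comp (TensorProduct.map_surjective hS hR)),
    fun t x => ?_⟩
  induction t with
  | zero => simp
  | add y z hy hz => simp only [map_add, add_mul, mul_add, hy, hz]
  | tmul a c =>
    -- ψ(a₁x)φ(R(ca₂)) = φ(R(c · ψ(a₁x)a₂)), and R reverses the product.
    have h1 : (φ ∘ₗ S) (sliceSnd (φ ∘ₗ R) (C.P₄ (a ⊗ₜ c)) * x) =
        φ (sliceFst (φ ∘ₗ S) (C.P₃ (a ⊗ₜ x)) * R c) := by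
      rw [← hRm', ← hRmul]
      change (φ ∘ₗ S) (LinearMap.mulRight ℂ x _) = (φ ∘ₗ R) (LinearMap.mulLeft ℂ c _)
      rw [← sliceSnd_rTensor, ← C.P₁_P₄, ← apply_sliceFst, sliceFst_lTensor]
    have h2 : φ (x * sliceFst φ (C.P₁ (S a ⊗ₜ R c))) =
        φ (sliceSnd φ (C.P₄ (R c ⊗ₜ x)) * S a) := by
      change φ (LinearMap.mulLeft ℂ x _) = φ (LinearMap.mulRight ℂ (S a) _)
      rw [← sliceFst_lTensor, C.P₁_P₄, apply_sliceFst, sliceSnd_rTensor]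
    -- Moving ψ = φ ∘ S outside leaves S applied to a · (ι ⊙ φ)(Δ(x)(1 ⊗ R(c)));
    -- antimultiplicativity and the defining formula of S then lead to `h2`.
    have h3 : φ (sliceFst (φ ∘ₗ S) (C.P₃ (a ⊗ₜ x)) * R c) =
        φ (S (a * sliceSnd φ (C.P₂ (x ⊗ₜ R c)))) := by
      change φ (LinearMap.mulRight ℂ (R c) _) = (φ ∘ₗ S) (LinearMap.mulLeft ℂ a _)
      rw [← sliceFst_lTensor, C.P₃_P₂, apply_sliceFst, sliceSnd_rTensor]
    change (φ ∘ₗ S) (sliceSnd (φ ∘ₗ R) (C.P₄ (a ⊗ₜ c)) * x) = _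
    rw [h1, h3, hSmul, hSm]
    exact h2.symm

/-- Multiplication is (ε ⊙ ι) ∘ `P₂`, a composite of surjections once ε ≠ 0; if ε vanished, all
products would vanish, contradicting non-degeneracy and φ ≠ 0. -/
theorem mul'_surjective (C : CoveringMaps A) {φ : Module.Dual ℂ A} (hφ0 : φ ≠ 0) :
    Function.Surjective (LinearMap.mul' ℂ A) := by
  obtain ⟨ε, hε⟩ := C.exists_counit hφ0
  have h : sliceFst ε ∘ₗ C.P₂.toLinearMap = LinearMap.mul' ℂ A := LinearMap.ext hε
  have hε0 : ε ≠ 0 := by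
    rintro rfl
    obtain ⟨d, hd⟩ := exists_apply_eq_one hφ0
    have : d = 0 := IsNondegenerate.eq_zero_of_mul_right d fun b => by
      have := hε (d ⊗ₜ b)
      rw [LinearMap.mul'_apply] at this
      rw [← this]
      simp [sliceFst]
    simp [this] at hd
  rw [← h]
  exact (sliceFst_surjective hε0).comp C.P₂.surjective

end CoveringMaps

end Covering

open Multiplier

/-! ### Multipliers over non-degenerate algebras. -/

section Multipliers

variable {A : Type*} [NonUnitalRing A] [Module ℂ A] [IsScalarTower ℂ A A] [SMulCommClass ℂ A A]

theorem left_tensor_incl_one (b : A) (z : A ⊗[ℂ] A) : left (tensor (incl b) (1 : Multiplier A)) z =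
    LinearMap.rTensor A (LinearMap.mulLeft ℂ b) z := rfl

theorem right_tensor_incl_one (b : A) (z : A ⊗[ℂ] A) : right (tensor (incl b) (1 : Multiplier A)) z =
    LinearMap.rTensor A (LinearMap.mulRight ℂ b) z := rfl

theorem left_tensor_one_incl (b : A) (z : A ⊗[ℂ] A) : left (tensor (1 : Multiplier A) (incl b)) z =
    LinearMap.lTensor A (LinearMap.mulLeft ℂ b) z := rfl

theorem right_tensor_one_incl (b : A) (z : A ⊗[ℂ] A) : right (tensor (1 : Multiplier A) (incl b)) z =
    LinearMap.lTensor A (LinearMap.mulRight ℂ b) z := rfl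

/-- A pair of linear maps `(L, R)` on a non-degenerate algebra with `a · L b = R a · b` is a
multiplier. -/
def mkOfMulEq [IsNondegenerate A] (L R : A →ₗ[ℂ] A) (h : ∀ a b, a * L b = R a * b) :
    Multiplier A :=
  Multiplier.mk L R
    (fun a b => eq_of_mul_left fun c => by rw [h, ← mul_assoc c, h, mul_assoc])
    (fun a b => eq_of_mul_right fun c => by rw [← h, mul_assoc, mul_assoc, h]) h

@[simp] theorem left_mkOfMulEq [IsNondegenerate A] (L R : A →ₗ[ℂ] A)
    (h : ∀ a b, a * L b = R a * b) : left (mkOfMulEq L R h) = L := rfl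

@[simp] theorem right_mkOfMulEq [IsNondegenerate A] (L R : A →ₗ[ℂ] A)
    (h : ∀ a b, a * L b = R a * b) : right (mkOfMulEq L R h) = R := rfl

theorem Multiplier.ext_left [IsNondegenerate A] {m n : Multiplier A} (h : left m = left n) :
    m = n :=
  Multiplier.ext h (LinearMap.ext fun a => eq_of_mul_right fun b => by
    rw [← mul_left_eq, ← mul_left_eq, h])

end Multipliers

/-! ### Naturality of the associator. -/

section AssocLemmas

variable {A B C D E : Type*} [AddCommGroup A] [Module ℂ A] [AddCommGroup B] [Module ℂ B]
  [AddCommGroup C] [Module ℂ C] [AddCommGroup D] [Module ℂ D] [AddCommGroup E] [Module ℂ E]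

theorem lTensor_lTensor_assoc (f : C →ₗ[ℂ] D) (z : (A ⊗[ℂ] B) ⊗[ℂ] C) :
    LinearMap.lTensor A (LinearMap.lTensor B f) (TensorProduct.assoc ℂ A B C z) =
      TensorProduct.assoc ℂ A B D (LinearMap.lTensor (A ⊗[ℂ] B) f z) := by
  have : LinearMap.lTensor A (LinearMap.lTensor B f) ∘ₗ (TensorProduct.assoc ℂ A B C).toLinearMap =
      (TensorProduct.assoc ℂ A B D).toLinearMap ∘ₗ (LinearMap.lTensor (A ⊗[ℂ] B) f) := by
    ext; simp
  exact LinearMap.congr_fun this z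

theorem lTensor_rTensor_assoc (f : B →ₗ[ℂ] D) (z : (A ⊗[ℂ] B) ⊗[ℂ] C) :
    LinearMap.lTensor A (LinearMap.rTensor C f) (TensorProduct.assoc ℂ A B C z) =
      TensorProduct.assoc ℂ A D C (LinearMap.rTensor C (LinearMap.lTensor A f) z) := by
  have : LinearMap.lTensor A (LinearMap.rTensor C f) ∘ₗ (TensorProduct.assoc ℂ A B C).toLinearMap =
      (TensorProduct.assoc ℂ A D C).toLinearMap ∘ₗ
        (LinearMap.rTensor C (LinearMap.lTensor A f)) := by
    ext; simp
  exact LinearMap.congr_fun this z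

theorem rTensor_assoc (f : A →ₗ[ℂ] D) (z : (A ⊗[ℂ] B) ⊗[ℂ] C) :
    LinearMap.rTensor (B ⊗[ℂ] C) f (TensorProduct.assoc ℂ A B C z) =
      TensorProduct.assoc ℂ D B C (LinearMap.rTensor C (LinearMap.rTensor B f) z) := by
  have : LinearMap.rTensor (B ⊗[ℂ] C) f ∘ₗ (TensorProduct.assoc ℂ A B C).toLinearMap =
      (TensorProduct.assoc ℂ D B C).toLinearMap ∘ₗ
        (LinearMap.rTensor C (LinearMap.rTensor B f)) := by
    ext; simp
  exact LinearMap.congr_fun this z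

theorem lTensor_rTensor_comm (f : A →ₗ[ℂ] C) (g : B →ₗ[ℂ] D) (z : A ⊗[ℂ] B) :
    LinearMap.lTensor C g (LinearMap.rTensor B f z) =
      LinearMap.rTensor D f (LinearMap.lTensor A g z) := by
  rw [← LinearMap.comp_apply, ← LinearMap.comp_apply, LinearMap.lTensor_comp_rTensor,
    LinearMap.rTensor_comp_lTensor]

end AssocLemmas

/-! ### Slicing multipliers of A ⊗ B on the B leg. -/

section SliceProducts

variable {A : Type*} [NonUnitalRing A] [Module ℂ A] [IsScalarTower ℂ A A] [SMulCommClass ℂ A A]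
  {B : Type*} [NonUnitalRing B] [Module ℂ B] [IsScalarTower ℂ B B] [SMulCommClass ℂ B B]

theorem sliceSnd_tmul_mul (η : Module.Dual ℂ B) (e : A) (x : B) (z : A ⊗[ℂ] B) :
    sliceSnd η (e ⊗ₜ x * z) = e * sliceSnd η (LinearMap.lTensor A (LinearMap.mulLeft ℂ x) z) := by
  induction z with
  | zero => simp
  | add y z hy hz => simp only [map_add, mul_add, hy, hz]
  | tmul u v => simp [mul_smul_comm]

theorem sliceSnd_mul_tmul (η : Module.Dual ℂ B) (e : A) (x : B) (z : A ⊗[ℂ] B) :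
    sliceSnd η (z * e ⊗ₜ x) = sliceSnd η (LinearMap.lTensor A (LinearMap.mulRight ℂ x) z) * e := by
  induction z with
  | zero => simp
  | add y z hy hz => simp only [map_add, add_mul, hy, hz]
  | tmul u v => simp [smul_mul_assoc]

theorem eq_of_forall_dual {V : Type*} [AddCommGroup V] [Module ℂ V] {v w : V}
    (h : ∀ η : Module.Dual ℂ V, η v = η w) : v = w := by
  rw [← sub_eq_zero, ← Module.forall_dual_apply_eq_zero_iff ℂ]
  exact fun η => by rw [map_sub, h, sub_self]

variable [IsNondegenerate A] [IsNondegenerate B]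

theorem left_mulRight_tmul (V : Multiplier (A ⊗[ℂ] B)) (a c : A) (x : B) :
    left V ((a * c) ⊗ₜ x) =
      LinearMap.rTensor B (LinearMap.mulRight ℂ c) (left V (a ⊗ₜ x)) :=
  left_tmul_mul V a c x

theorem right_mulLeft_tmul (V : Multiplier (A ⊗[ℂ] B)) (a c : A) (x : B) :
    right V ((c * a) ⊗ₜ x) =
      LinearMap.rTensor B (LinearMap.mulLeft ℂ c) (right V (a ⊗ₜ x)) := by
  have h : ∀ y z : A ⊗[ℂ] B, LinearMap.rTensor B (LinearMap.mulLeft ℂ c) z * y =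
      LinearMap.rTensor B (LinearMap.mulLeft ℂ c) (z * y) := fun y z => by
    induction z with
    | zero => simp
    | add z z' hz hz' => simp only [map_add, add_mul, hz, hz']
    | tmul u v =>
      induction y with
      | zero => simp
      | add z z' hz hz' => simp only [map_add, mul_add, hz, hz']
      | tmul p q => simp [mul_assoc]
  refine eq_of_mul_right fun y => ?_
  rw [← mul_left_eq, h, ← mul_left_eq, ← h]
  simp

/-- The multiplier `(ι ⊙ η)((1 ⊗ x) V (1 ⊗ x'))` of `A`. -/
def sandwichSlice (V : Multiplier (A ⊗[ℂ] B)) (η : Module.Dual ℂ B) (x x' : B) : Multiplier A :=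
  mkOfMulEq
    (sliceSnd η ∘ₗ LinearMap.lTensor A (LinearMap.mulLeft ℂ x) ∘ₗ left V ∘ₗ
      (TensorProduct.mk ℂ A B).flip x')
    (sliceSnd η ∘ₗ LinearMap.lTensor A (LinearMap.mulRight ℂ x') ∘ₗ right V ∘ₗ
      (TensorProduct.mk ℂ A B).flip x)
    (fun e d => by
      simp only [LinearMap.comp_apply, LinearMap.flip_apply, TensorProduct.mk_apply]
      rw [← sliceSnd_tmul_mul, ← sliceSnd_mul_tmul, mul_left_eq])

end SliceProducts

variable {A : Type*} [NonUnitalRing A] [Module ℂ A] [IsScalarTower ℂ A A] [SMulCommClass ℂ A A]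
  [IsNondegenerate A]

/-! ### The canonical maps of an algebraic quantum group, and coassociativity without multipliers.
-/

namespace AlgebraicQuantumGroup

variable (Q : AlgebraicQuantumGroup A)

theorem T₂_T₄ (b a x : A) : LinearMap.lTensor A (LinearMap.mulLeft ℂ b) (Q.T₂ (x ⊗ₜ a)) =
    LinearMap.lTensor A (LinearMap.mulRight ℂ a) (Q.T₄ (x ⊗ₜ b)) := by
  rw [← left_tensor_one_incl, ← right_tensor_one_incl]
  apply incl_injective
  rw [incl_right, incl_left, Q.T₂_spec, Q.T₄_spec, mul_assoc]

theorem T₃_T₂ (a x c : A) : LinearMap.lTensor A (LinearMap.mulRight ℂ c) (Q.T₃ (x ⊗ₜ a)) =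
    LinearMap.rTensor A (LinearMap.mulLeft ℂ a) (Q.T₂ (x ⊗ₜ c)) := by
  rw [← left_tensor_incl_one, ← right_tensor_one_incl]
  apply incl_injective
  rw [incl_right, incl_left, Q.T₂_spec, Q.T₃_spec, mul_assoc]

theorem T₁_T₄ (a x c : A) : LinearMap.lTensor A (LinearMap.mulLeft ℂ c) (Q.T₁ (x ⊗ₜ a)) =
    LinearMap.rTensor A (LinearMap.mulRight ℂ a) (Q.T₄ (x ⊗ₜ c)) := by
  rw [← right_tensor_incl_one, ← left_tensor_one_incl]
  apply incl_injective
  rw [incl_right, incl_left, Q.T₁_spec, Q.T₄_spec, mul_assoc]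

theorem T₁_T₃ (b a x : A) : LinearMap.rTensor A (LinearMap.mulLeft ℂ b) (Q.T₁ (x ⊗ₜ a)) =
    LinearMap.rTensor A (LinearMap.mulRight ℂ a) (Q.T₃ (x ⊗ₜ b)) :=
  (Q.T₃_T₁ x a b).symm

/-- Both sides are x₁a ⊗ x₂ ⊗ x₃c. Multiplying the middle leg by b on the right turns them into the
two sides of the coassociativity axiom applied to a ⊗ b ⊗ c, and b is cancelled afterwards. -/
theorem coassoc_T₁_T₂ (a x c : A) : TensorProduct.assoc ℂ A A A
      (LinearMap.rTensor A (Q.T₁.toLinearMap ∘ₗ (TensorProduct.mk ℂ A A).flip a)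
        (Q.T₂ (x ⊗ₜ c))) =
    LinearMap.lTensor A (Q.T₂.toLinearMap ∘ₗ (TensorProduct.mk ℂ A A).flip c) (Q.T₁ (x ⊗ₜ a)) := by
  refine eq_of_lTensor (fun b : A => LinearMap.rTensor A (LinearMap.mulRight ℂ b))
    (fun v hv => eq_of_rTensor_mulRight fun b => by rw [hv, map_zero]) fun b => ?_
  have h := congrArg (fun m : Multiplier (A ⊗[ℂ] (A ⊗[ℂ] A)) => left m (a ⊗ₜ (b ⊗ₜ c)))
    (Q.coassoc x)
  simp only [left_transport, TensorProduct.assoc_symm_tmul, coassoc_left, coassoc_right] at h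
  rw [lTensor_rTensor_assoc]
  convert h using 1
  · congr 1
    generalize Q.T₂ (x ⊗ₜ c) = z
    induction z with
    | zero => simp
    | add y z hy hz => simp only [map_add, LinearMap.add_apply, hy, hz]
    | tmul u v =>
      simp [← right_T₁]
      rfl
  · generalize Q.T₁ (x ⊗ₜ a) = z
    induction z with
    | zero => simp
    | add y z hy hz => simp only [map_add, LinearMap.add_apply, hy, hz]
    | tmul u v =>
      simp [← right_T₂]
      rfl

/-- Derived from `coassoc_T₁_T₂` by moving the factor covering the third leg from the right to the
left; `coassoc_T₃_T₂` does the same on the first leg. -/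
theorem coassoc_T₁_T₄ (a x c : A) : TensorProduct.assoc ℂ A A A
      (LinearMap.rTensor A (Q.T₁.toLinearMap ∘ₗ (TensorProduct.mk ℂ A A).flip a)
        (Q.T₄ (x ⊗ₜ c))) =
    LinearMap.lTensor A (Q.T₄.toLinearMap ∘ₗ (TensorProduct.mk ℂ A A).flip c) (Q.T₁ (x ⊗ₜ a)) := by
  refine eq_of_lTensor (fun b : A => LinearMap.lTensor A (LinearMap.mulRight ℂ b))
    (fun v hv => eq_of_lTensor_mulRight fun b => by rw [hv, map_zero]) fun b => ?_
  have h := congrArg (LinearMap.lTensor A (LinearMap.lTensor A (LinearMap.mulLeft ℂ c)))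
    (Q.coassoc_T₁_T₂ a x b)
  rw [lTensor_lTensor_assoc, lTensor_rTensor_comm, T₂_T₄] at h
  rw [lTensor_lTensor_assoc, lTensor_rTensor_comm, h, ← LinearMap.comp_apply,
    ← LinearMap.comp_apply, ← LinearMap.lTensor_comp, ← LinearMap.lTensor_comp]
  congr 2
  ext y
  simp [T₂_T₄]

theorem coassoc_T₃_T₂ (a x c : A) : TensorProduct.assoc ℂ A A A
      (LinearMap.rTensor A (Q.T₃.toLinearMap ∘ₗ (TensorProduct.mk ℂ A A).flip a)
        (Q.T₂ (x ⊗ₜ c))) =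
    LinearMap.lTensor A (Q.T₂.toLinearMap ∘ₗ (TensorProduct.mk ℂ A A).flip c) (Q.T₃ (x ⊗ₜ a)) := by
  refine eq_of_rTensor_mulRight fun b => ?_
  have h := congrArg (LinearMap.rTensor (A ⊗[ℂ] A) (LinearMap.mulLeft ℂ a)) (Q.coassoc_T₁_T₂ b x c)
  rw [rTensor_assoc, ← lTensor_rTensor_comm, T₁_T₃] at h
  rw [rTensor_assoc, ← lTensor_rTensor_comm, ← h, ← LinearMap.comp_apply,
    ← LinearMap.comp_apply, ← LinearMap.rTensor_comp, ← LinearMap.rTensor_comp]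
  congr 3
  ext y
  simp [T₁_T₃]

/-- The covering maps of an algebraic quantum group. -/
def coveringMaps : CoveringMaps A where
  P₁ := (TensorProduct.comm ℂ A A).trans Q.T₁
  P₂ := Q.T₂
  P₃ := (TensorProduct.comm ℂ A A).trans Q.T₃
  P₄ := Q.T₄
  D :=
    { toFun := fun x => left (Q.Δ x)
      map_add' := fun x y => by ext; simp
      map_smul' := fun r x => by ext; simp }
  D_tmul_P₁ x b s := (Q.right_T₁ x b s).symm
  D_tmul_P₂ x b s := (Q.right_T₂ x s b).symm
  D_P₁ x a y := by
    apply incl_injective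
    change incl (left (Q.Δ x) (Q.T₁ (y ⊗ₜ a))) = incl (Q.T₁ ((x * y) ⊗ₜ a))
    rw [incl_left, Q.T₁_spec, Q.T₁_spec, map_mul, mul_assoc]
  D_P₂ x y c := by
    apply incl_injective
    change incl (left (Q.Δ x) (Q.T₂ (y ⊗ₜ c))) = incl (Q.T₂ ((x * y) ⊗ₜ c))
    rw [incl_left, Q.T₂_spec, Q.T₂_spec, map_mul, mul_assoc]
  P₃_P₂ := Q.T₃_T₂
  P₁_P₄ := Q.T₁_T₄
  coassoc₃₂ := Q.coassoc_T₃_T₂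
  coassoc₁₄ := Q.coassoc_T₁_T₄

/-! ### Right Haar functionals and the exchange of φ(· a) for ψ(b ·). -/

theorem sliceSnd_φ_T₁ (c d : A) : sliceSnd Q.φ (Q.T₁ (c ⊗ₜ d)) = Q.φ c • d := by
  rw [← Q.left_sndSlice, Q.left_invariant, left_smul, left_one]

theorem sliceSnd_φ_T₃ (c d : A) : sliceSnd Q.φ (Q.T₃ (c ⊗ₜ d)) = Q.φ c • d := by
  rw [← Q.right_sndSlice, Q.left_invariant, right_smul, right_one]

/-- `ψ` is a right Haar functional: `(ψ ⊙ ι)Δ(a) = ψ(a) 1`. -/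
structure IsRightHaar (ψ : Module.Dual ℂ A) : Prop where
  ne_zero : ψ ≠ 0
  T₂ : ∀ z d, sliceFst ψ (Q.T₂ (z ⊗ₜ d)) = ψ z • d
  T₄ : ∀ z d, sliceFst ψ (Q.T₄ (z ⊗ₜ d)) = ψ z • d

theorem exists_right_haar : ∃ ψ : Module.Dual ℂ A, Q.IsRightHaar ψ ∧
    (∀ a, ∃ b, ∀ x, Q.φ (x * a) = ψ (b * x)) ∧ ∀ b, ∃ a, ∀ x, Q.φ (x * a) = ψ (b * x) := by
  obtain ⟨ψ, h0, h1, p, q, hp, hq, h2⟩ :=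
    Q.coveringMaps.exists_right_invariant Q.φ_ne_zero fun d c => Q.sliceSnd_φ_T₁ c d
  have h1' : ∀ z d, sliceFst ψ (Q.T₂ (z ⊗ₜ d)) = ψ z • d := h1
  refine ⟨ψ, ⟨h0, h1, fun z d => eq_of_mul_right fun e => ?_⟩, fun a => ?_, fun b => ?_⟩
  -- Invariance is known for Δ(z)(1 ⊗ d); multiplying by e on the right transfers it to (1 ⊗ d)Δ(z).
  · change LinearMap.mulRight ℂ e _ = _
    rw [← sliceFst_lTensor, ← T₂_T₄, sliceFst_lTensor, h1']
    simp [mul_smul_comm, smul_mul_assoc]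
  · obtain ⟨t, rfl⟩ := hq a
    exact ⟨p t, fun x => (h2 t x).symm⟩
  · obtain ⟨t, rfl⟩ := hp b
    exact ⟨q t, fun x => (h2 t x).symm⟩

section Modular

variable {Q} {ψ : Module.Dual ℂ A} (hψ : Q.IsRightHaar ψ)
include hψ

/-- (ψ ⊙ φ)(Δ(x)t) is evaluated in two ways. Writing t through `T₂` and using right invariance of ψ
gives ψ(xa); writing t through `T₁` and using left invariance of φ gives φ(xb). -/
theorem IsRightHaar.exists_φ_mul_right (a : A) : ∃ b, ∀ x, ψ (x * a) = Q.φ (x * b) := by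
  obtain ⟨t, rfl⟩ := ((sliceSnd_surjective Q.φ_ne_zero).comp Q.T₂.symm.surjective) a
  refine ⟨sliceFst ψ (TensorProduct.comm ℂ A A (Q.T₁.symm t)), fun x => ?_⟩
  have h1 : ∀ z, Q.φ (x * sliceFst ψ (TensorProduct.comm ℂ A A z)) =
      ψ (sliceSnd Q.φ (left (Q.Δ x) (Q.T₁ z))) := fun z => by
    induction z with
    | zero => simp
    | add y z hy hz => simp only [map_add, mul_add, hy, hz]
    | tmul y c =>
      have : left (Q.Δ x) (Q.T₁ (y ⊗ₜ c)) = Q.T₁ ((x * y) ⊗ₜ c) := Q.coveringMaps.D_P₁ x c y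
      simp [this, sliceSnd_φ_T₁, mul_smul_comm, mul_comm]
  have h2 : ∀ z, ψ (x * sliceSnd Q.φ z) = ψ (sliceSnd Q.φ (left (Q.Δ x) (Q.T₂ z))) := fun z => by
    induction z with
    | zero => simp
    | add y z hy hz => simp only [map_add, mul_add, hy, hz]
    | tmul y c =>
      have : left (Q.Δ x) (Q.T₂ (y ⊗ₜ c)) = Q.T₂ ((x * y) ⊗ₜ c) := Q.coveringMaps.D_P₂ x y c
      simp [this, ← apply_sliceFst, hψ.T₂, mul_smul_comm, mul_comm]
  rw [h1, Function.comp_apply, h2, LinearEquiv.apply_symm_apply, LinearEquiv.apply_symm_apply]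

/-- The mirror argument: (ψ ⊙ φ)(tΔ(x)) is evaluated through `T₃` and `T₄`. -/
theorem IsRightHaar.exists_φ_mul_left (b : A) : ∃ a, ∀ x, Q.φ (b * x) = ψ (a * x) := by
  obtain ⟨t, rfl⟩ := ((sliceSnd_surjective (W := A) hψ.ne_zero).comp Q.T₃.symm.surjective) b
  refine ⟨sliceSnd Q.φ (Q.T₄.symm t), fun x => ?_⟩
  have h1 : ∀ z, Q.φ (sliceSnd ψ z * x) =
      ψ (sliceSnd Q.φ (right (Q.Δ x) (Q.T₃ z))) := fun z => by
    induction z with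
    | zero => simp
    | add y z hy hz => simp only [map_add, add_mul, hy, hz]
    | tmul y c =>
      have : right (Q.Δ x) (Q.T₃ (y ⊗ₜ c)) = Q.T₃ ((y * x) ⊗ₜ c) := by
        apply incl_injective
        rw [incl_right, Q.T₃_spec, Q.T₃_spec, map_mul, mul_assoc]
      simp [this, sliceSnd_φ_T₃, smul_mul_assoc, mul_comm]
  have h2 : ∀ z, ψ (sliceSnd Q.φ z * x) = ψ (sliceSnd Q.φ (right (Q.Δ x) (Q.T₄ z))) := fun z => by
    induction z with
    | zero => simp
    | add y z hy hz => simp only [map_add, add_mul, hy, hz]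
    | tmul y c =>
      have : right (Q.Δ x) (Q.T₄ (y ⊗ₜ c)) = Q.T₄ ((y * x) ⊗ₜ c) := by
        apply incl_injective
        rw [incl_right, Q.T₄_spec, Q.T₄_spec, map_mul, mul_assoc]
      simp [this, ← apply_sliceFst, hψ.T₄, smul_mul_assoc, mul_comm]
  rw [h2, Function.comp_apply, h1, LinearEquiv.apply_symm_apply, LinearEquiv.apply_symm_apply]

end Modular

/-- The pairs `(a, b)` with `φ(m a) = ψ(b m)` for all multipliers `m` of `A`. -/
def modularPairs (ψ : Module.Dual ℂ A) : Submodule ℂ (A × A) where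
  carrier := {p | ∀ m : Multiplier A, Q.φ (left m p.1) = ψ (right m p.2)}
  add_mem' h h' m := by simp [h m, h' m]
  zero_mem' m := by simp
  smul_mem' r p h m := by simp [h m]

theorem mul_eq_of_mem_modularPairs {ψ : Module.Dual ℂ A} {a b : A} (h : (a, b) ∈ Q.modularPairs ψ)
    (x : A) : Q.φ (x * a) = ψ (b * x) := h (incl x)

/-- There is a right Haar functional `ψ`, together with a linear map `ρ` such that
`φ(m a) = ψ(ρ(a) m)` for all multipliers `m`; and every `b` is the second entry of such a pair. -/
theorem exists_right_haar_modularPairs : ∃ ψ : Module.Dual ℂ A, Q.IsRightHaar ψ ∧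
    (∃ ρ : A →ₗ[ℂ] A, ∀ a, (a, ρ a) ∈ Q.modularPairs ψ) ∧
      ∀ b, ∃ a, (a, b) ∈ Q.modularPairs ψ := by
  obtain ⟨ψ, hψ, h1, h2⟩ := Q.exists_right_haar
  have hA := Q.coveringMaps.mul'_surjective Q.φ_ne_zero
  have h3 : ∀ a, ∃ b, (a, b) ∈ Q.modularPairs ψ := fun a => by
    obtain ⟨t, rfl⟩ := hA a
    induction t with
    | zero => exact ⟨0, by rw [map_zero]; exact zero_mem _⟩
    | add y z hy hz =>
      obtain ⟨b, hb⟩ := hy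
      obtain ⟨c, hc⟩ := hz
      exact ⟨b + c, by simpa using add_mem hb hc⟩
    | tmul a₁ a₂ =>
      obtain ⟨b₂, hb₂⟩ := h1 a₂
      obtain ⟨c, hc⟩ := hψ.exists_φ_mul_right a₁
      obtain ⟨b₁, hb₁⟩ := h1 c
      -- Factoring a = a₁a₂ keeps every argument of φ and ψ inside A: φ(ma₁a₂) = ψ(b₂(ma₁)) =
      -- ψ((b₂m)a₁) = φ((b₂m)c) = ψ(b₁b₂m).
      refine ⟨b₁ * b₂, fun m => ?_⟩
      rw [LinearMap.mul'_apply, left_apply_mul, hb₂, mul_left_eq, hc, hb₁, right_apply_mul]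
  refine ⟨ψ, hψ, ?_, fun b => ?_⟩
  · have hr : LinearMap.range (LinearMap.fst ℂ A A ∘ₗ (Q.modularPairs ψ).subtype) = ⊤ := by
      refine LinearMap.range_eq_top.2 fun a => ?_
      obtain ⟨b, hb⟩ := h3 a
      exact ⟨⟨_, hb⟩, rfl⟩
    refine ⟨LinearMap.snd ℂ A A ∘ₗ (Q.modularPairs ψ).subtype ∘ₗ linearSection _ hr, fun a => ?_⟩
    have h4 := (linearSection _ hr a).2
    have h5 : (linearSection _ hr a).1.1 = a := linearSection_spec _ hr a
    convert h4 using 1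
    exact Prod.ext h5.symm rfl
  · obtain ⟨t, rfl⟩ := hA b
    induction t with
    | zero => exact ⟨0, by rw [map_zero]; exact zero_mem _⟩
    | add y z hy hz =>
      obtain ⟨b, hb⟩ := hy
      obtain ⟨c, hc⟩ := hz
      exact ⟨b + c, by simpa using add_mem hb hc⟩
    | tmul b₁ b₂ =>
      obtain ⟨a₁, ha₁⟩ := h2 b₁
      obtain ⟨c, hc⟩ := hψ.exists_φ_mul_left b₂
      obtain ⟨a₂, ha₂⟩ := h2 c
      -- Likewise ψ(b₁(b₂m)) = φ((b₂m)a₁) = φ(b₂(ma₁)) = ψ(c(ma₁)) = φ(ma₁a₂).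
      refine ⟨a₁ * a₂, fun m => ?_⟩
      simp only [LinearMap.mul'_apply]
      rw [right_apply_mul, ← ha₁, ← mul_left_eq, hc, ← ha₂, left_apply_mul]

/-! ### The homomorphism π_V and its relation to V. -/

section InducedHom

variable {B : Type*} [NonUnitalRing B] [Module ℂ B] [IsScalarTower ℂ B B] [SMulCommClass ℂ B B]

theorem left_leg23 (V : Multiplier (A ⊗[ℂ] B)) (a c : A) (x : B) :
    left (leg23 V) (a ⊗ₜ c ⊗ₜ x) = (TensorProduct.assoc ℂ A A B).symm (a ⊗ₜ left V (c ⊗ₜ x)) := rfl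

theorem left_leg13 (V : Multiplier (A ⊗[ℂ] B)) (a c : A) (x : B) :
    left (leg13 V) (a ⊗ₜ c ⊗ₜ x) = TensorProduct.rightComm ℂ A B A (left V (a ⊗ₜ x) ⊗ₜ c) := rfl

theorem right_leg23 (V : Multiplier (A ⊗[ℂ] B)) (a c : A) (x : B) :
    right (leg23 V) (a ⊗ₜ c ⊗ₜ x) =
      (TensorProduct.assoc ℂ A A B).symm (a ⊗ₜ right V (c ⊗ₜ x)) := rfl

theorem right_leg13 (V : Multiplier (A ⊗[ℂ] B)) (a c : A) (x : B) :
    right (leg13 V) (a ⊗ₜ c ⊗ₜ x) =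
      TensorProduct.rightComm ℂ A B A (right V (a ⊗ₜ x) ⊗ₜ c) := rfl

variable [IsNondegenerate B]

/-- After applying a functional η on B, the claim is φ(ma) = ψ(bm) for m = (ι ⊙ η)((1 ⊗ x)V(1 ⊗
x')). This m is only a multiplier of A, which is why modular pairs are tested on multipliers. The
identity provides the right multiplication belonging to (aφ ⊙ ι)(V). -/
theorem mul_sliceFst_left {ψ : Module.Dual ℂ A} {a b : A} (h : (a, b) ∈ Q.modularPairs ψ)
    (V : Multiplier (A ⊗[ℂ] B)) (x x' : B) :
    x * sliceFst Q.φ (left V (a ⊗ₜ x')) = sliceFst ψ (right V (b ⊗ₜ x)) * x' := by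
  refine eq_of_forall_dual fun η => ?_
  change η (LinearMap.mulLeft ℂ x _) = η (LinearMap.mulRight ℂ x' _)
  rw [← sliceFst_lTensor Q.φ (LinearMap.mulLeft ℂ x), ← sliceFst_lTensor ψ (LinearMap.mulRight ℂ x'),
    apply_sliceFst, apply_sliceFst]
  exact h (sandwichSlice V η x x')

/-- The corepresentation identity applied to Δ(p)(q ⊗ 1) ⊗ x. The extension of Δ ⊙ ι is directly
computable on Δ(p)(q ⊗ d) ⊗ x; the factor d commutes with left multiplications and is cancelled. -/
theorem left_corep {V : Multiplier (A ⊗[ℂ] B)} (hV : Q.IsCorepresentation V) (p q : A) (x : B) :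
    left (leg13 V) (left (leg23 V) (Q.T₁ (p ⊗ₜ q) ⊗ₜ x)) =
      LinearMap.rTensor B (Q.T₁.toLinearMap ∘ₗ (TensorProduct.mk ℂ A A).flip q)
        (left V (p ⊗ₜ x)) := by
  have h1 : ∀ (d : A) (w : A ⊗[ℂ] A),
      left (leg13 V) (left (leg23 V) (LinearMap.lTensor A (LinearMap.mulRight ℂ d) w ⊗ₜ x)) =
      LinearMap.rTensor B (LinearMap.lTensor A (LinearMap.mulRight ℂ d))
        (left (leg13 V) (left (leg23 V) (w ⊗ₜ x))) := fun d w => by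
    induction w with
    | zero => simp
    | add y z hy hz => simp only [map_add, TensorProduct.add_tmul, hy, hz]
    | tmul a c =>
      simp only [LinearMap.lTensor_tmul, LinearMap.mulRight_apply, left_leg23, left_mulRight_tmul]
      generalize left V (c ⊗ₜ x) = z
      induction z with
      | zero => simp
      | add y z hy hz => simp only [map_add, TensorProduct.tmul_add, hy, hz]
      | tmul r y =>
        simp only [LinearMap.rTensor_tmul, LinearMap.mulRight_apply,
          TensorProduct.assoc_symm_tmul, left_leg13]
        generalize left V (a ⊗ₜ y) = z
        induction z with
        | zero => simp
        | add y z hy hz => simp only [map_add, TensorProduct.add_tmul, hy, hz]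
        | tmul u v => simp
  refine eq_of_rTensor (fun d : A => LinearMap.lTensor A (LinearMap.mulRight ℂ d))
    (fun v hv => eq_of_lTensor_mulRight fun d => by rw [hv, map_zero]) fun d => ?_
  have h2 := left_extFst Q.Δ Q.Δ_nondeg V p x (q ⊗ₜ d)
  rw [show extFst Q.Δ Q.Δ_nondeg V = _ from hV, left_mul, ← right_T₁, right_tensor_one_incl,
    h1] at h2
  rw [h2]
  generalize left V (p ⊗ₜ x) = z
  induction z with
  | zero => simp
  | add y z hy hz => simp only [map_add, LinearMap.add_apply, hy, hz]
  | tmul u v =>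
    simp [← right_T₁]
    rfl

/-- The same argument on the right, for (1 ⊗ q)Δ(p) ⊗ x, with a factor d cancelled on the first leg.
-/
theorem right_corep {V : Multiplier (A ⊗[ℂ] B)} (hV : Q.IsCorepresentation V) (p q : A) (x : B) :
    right (leg23 V) (right (leg13 V) (Q.T₄ (p ⊗ₜ q) ⊗ₜ x)) =
      LinearMap.rTensor B (Q.T₄.toLinearMap ∘ₗ (TensorProduct.mk ℂ A A).flip q)
        (right V (p ⊗ₜ x)) := by
  have h0 : ∀ r d : A, right (Q.Δ r) (d ⊗ₜ q) =
      LinearMap.rTensor A (LinearMap.mulLeft ℂ d) (Q.T₄ (r ⊗ₜ q)) := fun r d => by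
    apply incl_injective
    rw [← left_tensor_incl_one, incl_left, incl_right, Q.T₄_spec, ← mul_assoc]
    congr 1
    refine Multiplier.ext ?_ ?_ <;> ext p q <;> simp
  have h1 : ∀ (d : A) (w : A ⊗[ℂ] A),
      right (leg23 V) (right (leg13 V) (LinearMap.rTensor A (LinearMap.mulLeft ℂ d) w ⊗ₜ x)) =
      LinearMap.rTensor B (LinearMap.rTensor A (LinearMap.mulLeft ℂ d))
        (right (leg23 V) (right (leg13 V) (w ⊗ₜ x))) := fun d w => by
    induction w with
    | zero => simp
    | add y z hy hz => simp only [map_add, TensorProduct.add_tmul, hy, hz]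
    | tmul a c =>
      simp only [LinearMap.rTensor_tmul, LinearMap.mulLeft_apply, right_leg13, right_mulLeft_tmul]
      generalize right V (a ⊗ₜ x) = z
      induction z with
      | zero => simp
      | add y z hy hz => simp only [map_add, TensorProduct.add_tmul, hy, hz]
      | tmul r y =>
        simp only [LinearMap.rTensor_tmul, LinearMap.mulLeft_apply,
          TensorProduct.rightComm_tmul, right_leg23]
        generalize right V (c ⊗ₜ y) = z
        induction z with
        | zero => simp
        | add y z hy hz => simp only [map_add, TensorProduct.tmul_add, hy, hz]
        | tmul u v => simp
  refine eq_of_rTensor (fun d : A => LinearMap.rTensor A (LinearMap.mulLeft ℂ d))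
    (fun v hv => eq_of_rTensor_mulLeft fun d => by rw [hv, map_zero]) fun d => ?_
  have h2 := right_extFst Q.Δ Q.Δ_nondeg V p x (d ⊗ₜ q)
  rw [show extFst Q.Δ Q.Δ_nondeg V = _ from hV, right_mul, h0, h1] at h2
  rw [h2]
  generalize right V (p ⊗ₜ x) = z
  induction z with
  | zero => simp
  | add y z hy hz => simp only [map_add, LinearMap.add_apply, hy, hz]
  | tmul u v => simp [h0]

/-- The map `a ↦ (ω ⊙ ι)(V (a ⊗ x))`. -/
def leftFst (ω : Module.Dual ℂ A) (V : Multiplier (A ⊗[ℂ] B)) (x : B) : A →ₗ[ℂ] B :=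
  sliceFst ω ∘ₗ left V ∘ₗ (TensorProduct.mk ℂ A B).flip x

/-- The map `a ↦ (ω ⊙ ι)((a ⊗ x) V)`. -/
def rightFst (ω : Module.Dual ℂ A) (V : Multiplier (A ⊗[ℂ] B)) (x : B) : A →ₗ[ℂ] B :=
  sliceFst ω ∘ₗ right V ∘ₗ (TensorProduct.mk ℂ A B).flip x

/-- `V (a ⊗ (φ ⊙ ι)(V (c ⊗ x))) = q ⊗ (φ ⊙ ι)(V (p ⊗ x))` for `a ⊗ c = Δ(p) (q ⊗ 1)`. -/
theorem left_lTensor_T₁ {V : Multiplier (A ⊗[ℂ] B)} (hV : Q.IsCorepresentation V) (p q : A)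
    (x : B) : left V (LinearMap.lTensor A (leftFst Q.φ V x) (Q.T₁ (p ⊗ₜ q))) =
      q ⊗ₜ leftFst Q.φ V x p := by
  -- Slicing the second leg leaves V₁₃ untouched and turns V₂₃ into `leftFst`; on the other side
  -- left invariance replaces u₁q φ(u₂) by φ(u)q.
  have h := congrArg (LinearMap.rTensor B (sliceSnd Q.φ)) (Q.left_corep hV p q x)
  have h1 : ∀ w : A ⊗[ℂ] A, LinearMap.rTensor B (sliceSnd Q.φ)
      (left (leg13 V) (left (leg23 V) (w ⊗ₜ x))) =
      left V (LinearMap.lTensor A (leftFst Q.φ V x) w) := fun w => by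
    induction w with
    | zero => simp
    | add y z hy hz => simp only [map_add, TensorProduct.add_tmul, hy, hz]
    | tmul a c =>
      simp only [LinearMap.lTensor_tmul, left_leg23, leftFst, LinearMap.comp_apply,
        LinearMap.flip_apply, TensorProduct.mk_apply]
      generalize left V (c ⊗ₜ x) = z
      induction z with
      | zero => simp
      | add y z hy hz => simp only [map_add, TensorProduct.tmul_add, hy, hz]
      | tmul r y =>
        simp only [TensorProduct.assoc_symm_tmul, left_leg13, sliceFst_tmul,
          TensorProduct.tmul_smul, map_smul]
        generalize left V (a ⊗ₜ y) = z
        induction z with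
        | zero => simp
        | add y z hy hz => simp only [map_add, TensorProduct.add_tmul, smul_add, hy, hz]
        | tmul u v => simp [TensorProduct.smul_tmul']
  rw [h1] at h
  rw [h, leftFst, LinearMap.comp_apply, LinearMap.comp_apply, LinearMap.flip_apply,
    TensorProduct.mk_apply]
  generalize left V (p ⊗ₜ x) = z
  induction z with
  | zero => simp
  | add y z hy hz => simp only [map_add, TensorProduct.tmul_add, hy, hz]
  | tmul u v => simp [sliceSnd_φ_T₁, TensorProduct.smul_tmul']

/-- `(c ⊗ (ψ ⊙ ι)((b ⊗ x) V)) V = q ⊗ (ψ ⊙ ι)((p ⊗ x) V)` for `b ⊗ c = (1 ⊗ q) Δ(p)`. -/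
theorem right_lTensor_T₄ {ψ : Module.Dual ℂ A} (hψ : Q.IsRightHaar ψ)
    {V : Multiplier (A ⊗[ℂ] B)} (hV : Q.IsCorepresentation V) (p q : A)
    (x : B) : right V (LinearMap.lTensor A (rightFst ψ V x)
        (TensorProduct.comm ℂ A A (Q.T₄ (p ⊗ₜ q)))) =
      q ⊗ₜ rightFst ψ V x p := by
  -- Here the first leg is sliced, and right invariance of ψ is what collapses `T₄`.
  have h := congrArg (LinearMap.rTensor B (sliceFst ψ)) (Q.right_corep hV p q x)
  have h1 : ∀ w : A ⊗[ℂ] A, LinearMap.rTensor B (sliceFst ψ)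
      (right (leg23 V) (right (leg13 V) (w ⊗ₜ x))) =
      right V (LinearMap.lTensor A (rightFst ψ V x) (TensorProduct.comm ℂ A A w)) := fun w => by
    induction w with
    | zero => simp
    | add y z hy hz => simp only [map_add, TensorProduct.add_tmul, hy, hz]
    | tmul a c =>
      simp only [LinearMap.lTensor_tmul, right_leg13, rightFst, LinearMap.comp_apply,
        LinearMap.flip_apply, TensorProduct.mk_apply, TensorProduct.comm_tmul]
      generalize right V (a ⊗ₜ x) = z
      induction z with
      | zero => simp
      | add y z hy hz =>
        simp only [map_add, TensorProduct.add_tmul, TensorProduct.tmul_add, hy, hz]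
      | tmul r y =>
        simp only [TensorProduct.rightComm_tmul, right_leg23, sliceFst_tmul,
          TensorProduct.tmul_smul, map_smul]
        generalize right V (c ⊗ₜ y) = z
        induction z with
        | zero => simp
        | add y z hy hz => simp only [map_add, TensorProduct.tmul_add, smul_add, hy, hz]
        | tmul u v => simp [TensorProduct.smul_tmul']
  rw [h1] at h
  rw [h, rightFst, LinearMap.comp_apply, LinearMap.comp_apply, LinearMap.flip_apply,
    TensorProduct.mk_apply]
  generalize right V (p ⊗ₜ x) = z
  induction z with
  | zero => simp
  | add y z hy hz => simp only [map_add, TensorProduct.tmul_add, hy, hz]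
  | tmul u v => simp [hψ.T₄, TensorProduct.smul_tmul']

theorem leftSlice_dual (V : Multiplier (A ⊗[ℂ] B)) (ω : Q.dual) (x : B) :
    leftSlice V ⟨ω, Q.dual_le_circ ω.2⟩ x = leftFst Q.φ V x (Q.rep ω) := by
  have := leftSlice_act Q V (Q.rep ω) Q.φ x
  simp only [Q.act_rep ω] at this
  exact this

theorem leftSlice_toDual (V : Multiplier (A ⊗[ℂ] B)) (a : A) (x : B) :
    leftSlice V ⟨Q.toDual a, Q.dual_le_circ (Q.toDual a).2⟩ x = leftFst Q.φ V x a :=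
  leftSlice_act Q V a Q.φ x

/-- Makes the product of Â explicit in terms of `T₁`⁻¹, matching the shape of `left_lTensor_T₁`. -/
theorem dual_mul_eq (ω₁ ω₂ : Q.dual) :
    ω₁ * ω₂ = Q.toDual (sliceSnd Q.φ (Q.T₁.symm (Q.rep ω₁ ⊗ₜ Q.rep ω₂))) := by
  refine Subtype.ext (LinearMap.ext fun x => ?_)
  rw [coe_toDual, act_apply, ← left_Δ_T₁, LinearEquiv.apply_symm_apply,
    dual_mul_apply, Q.apply_dualSlice ω₁ ω₂ x _ _ (Q.act_rep ω₁).symm (Q.act_rep ω₂).symm]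

theorem exists_isInducedHom {ψ : Module.Dual ℂ A} {ρ : A →ₗ[ℂ] A}
    (hρ : ∀ a, (a, ρ a) ∈ Q.modularPairs ψ) {V : Multiplier (A ⊗[ℂ] B)}
    (hV : Q.IsCorepresentation V) : ∃ π : Q.dual →ₙₐ[ℂ] Multiplier B, Q.IsInducedHom V π := by
  let m : Q.dual → Multiplier B := fun ω =>
    mkOfMulEq (leftSlice V ⟨ω, Q.dual_le_circ ω.2⟩)
      (sliceFst ψ ∘ₗ right V ∘ₗ TensorProduct.mk ℂ A B (ρ (Q.rep ω)))
      (fun x x' => by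
        rw [leftSlice_dual]
        exact Q.mul_sliceFst_left (hρ _) V x x')
  have hm : ∀ ω, left (m ω) = leftSlice V ⟨ω, Q.dual_le_circ ω.2⟩ := fun ω => rfl
  refine ⟨
    { toFun := m
      map_smul' := fun r ω => Multiplier.ext_left (LinearMap.ext fun x => by
        simp only [hm, left_smul, leftSlice_dual, map_smul, MonoidHom.id_apply])
      map_zero' := Multiplier.ext_left (LinearMap.ext fun x => by
        simp only [hm, left_zero, leftSlice_dual, map_zero])
      map_add' := fun ω ω' => Multiplier.ext_left (LinearMap.ext fun x => by
        simp only [hm, left_add, leftSlice_dual, map_add])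
      map_mul' := fun ω₁ ω₂ => Multiplier.ext_left (LinearMap.ext fun x => ?_) }, hm⟩
  -- The φ-slice of `left_lTensor_T₁`. At t = `T₁`⁻¹(a₁ ⊗ a₂) its left side is π(a₁φ)π(a₂φ)x, and by
  -- `dual_mul_eq` its right side is π of the product applied to x.
  have h1 : ∀ t : A ⊗[ℂ] A, sliceFst Q.φ (left V (LinearMap.lTensor A (leftFst Q.φ V x)
      (Q.T₁ t))) = leftFst Q.φ V x (sliceSnd Q.φ t) := fun t => by
    induction t with
    | zero => simp
    | add y z hy hz => simp only [map_add, hy, hz]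
    | tmul p q => simp [Q.left_lTensor_T₁ hV]
  have h2 : leftSlice V ⟨(ω₁ * ω₂ : Q.dual), Q.dual_le_circ (ω₁ * ω₂).2⟩ x =
      leftFst Q.φ V x (sliceSnd Q.φ (Q.T₁.symm (Q.rep ω₁ ⊗ₜ Q.rep ω₂))) := by
    simp only [Q.dual_mul_eq ω₁ ω₂, leftSlice_toDual]
  rw [hm, h2, ← h1, LinearEquiv.apply_symm_apply, left_mul, hm, hm, leftSlice_dual, leftSlice_dual]
  rfl

theorem IsInducedHom.left_toDual {V : Multiplier (A ⊗[ℂ] B)} {π : Q.dual →ₙₐ[ℂ] Multiplier B}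
    (hπ : Q.IsInducedHom V π) (a : A) (x : B) :
    left (π (Q.toDual a)) x = leftFst Q.φ V x a := by
  rw [hπ, leftSlice_toDual]

theorem IsInducedHom.right_toDual {V : Multiplier (A ⊗[ℂ] B)} {π : Q.dual →ₙₐ[ℂ] Multiplier B}
    (hπ : Q.IsInducedHom V π) {ψ : Module.Dual ℂ A} {a b : A} (h : (a, b) ∈ Q.modularPairs ψ)
    (x : B) : right (π (Q.toDual a)) x = rightFst ψ V x b :=
  eq_of_mul_right fun y => by
    rw [← mul_left_eq, hπ.left_toDual]
    exact Q.mul_sliceFst_left h V x y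

theorem IsInducedHom.unique {V : Multiplier (A ⊗[ℂ] B)} {π π' : Q.dual →ₙₐ[ℂ] Multiplier B}
    (hπ : Q.IsInducedHom V π) (hπ' : Q.IsInducedHom V π') : π' = π := by
  ext1 ω
  exact Multiplier.ext_left (by rw [hπ, hπ'])

/-- If Vz = 0 then (yV)z = y(Vz) = 0 for all y, so surjectivity of right multiplication and
non-degeneracy force z = 0; symmetrically on the other side. The two inverse maps satisfy the
multiplier identity because V does. -/
theorem isUnit_iff_surjective {C : Type*} [NonUnitalRing C] [Module ℂ C] [IsScalarTower ℂ C C]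
    [SMulCommClass ℂ C C] [IsNondegenerate C] (V : Multiplier C) :
    IsUnit V ↔ Function.Surjective (left V) ∧ Function.Surjective (right V) := by
  refine ⟨fun h => ?_, fun ⟨hl, hr⟩ => ?_⟩
  · obtain ⟨W, h1, h2⟩ := isUnit_iff_exists.1 h
    exact ⟨fun z => ⟨left W z, by rw [← left_mul, h1, left_one]⟩,
      fun z => ⟨right W z, by rw [← right_mul, h2, right_one]⟩⟩
  · have hl' : Function.Injective (left V) := (injective_iff_map_eq_zero _).2 fun z hz =>
      IsNondegenerate.eq_zero_of_mul_left _ fun y => by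
        obtain ⟨w, rfl⟩ := hr y
        rw [← mul_left_eq, hz, mul_zero]
    have hr' : Function.Injective (right V) := (injective_iff_map_eq_zero _).2 fun z hz =>
      IsNondegenerate.eq_zero_of_mul_right _ fun y => by
        obtain ⟨w, rfl⟩ := hl y
        rw [mul_left_eq, hz, zero_mul]
    let e := LinearEquiv.ofBijective (left V) ⟨hl', hl⟩
    let f := LinearEquiv.ofBijective (right V) ⟨hr', hr⟩
    have he : ∀ z, left V (e.symm z) = z := e.apply_symm_apply
    have hf : ∀ z, right V (f.symm z) = z := f.apply_symm_apply
    let W : Multiplier C := mkOfMulEq e.symm.toLinearMap f.symm.toLinearMap fun a b => by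
      have := mul_left_eq V (f.symm a) (e.symm b)
      rw [he, hf] at this
      exact this.symm
    refine isUnit_iff_exists.2 ⟨W, Multiplier.ext_left (LinearMap.ext he),
      Multiplier.ext_left (LinearMap.ext fun z => e.symm_apply_apply z)⟩

theorem toDual_surjective (ω : Q.dual) : ∃ a, Q.toDual a = ω := ⟨_, Q.toDual_rep ω⟩

theorem tmul_span_eq_top {S : Set B} (hS : Submodule.span ℂ S = ⊤) (W : Submodule ℂ (A ⊗[ℂ] B))
    (h : ∀ q, ∀ y ∈ S, q ⊗ₜ y ∈ W) : W = ⊤ := by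
  have h1 : ∀ q y, q ⊗ₜ y ∈ W := fun q => by
    have : Submodule.span ℂ S ≤ W.comap (TensorProduct.mk ℂ A B q) :=
      Submodule.span_le.2 fun y hy => h q y hy
    rw [hS] at this
    exact fun y => this trivial
  rw [eq_top_iff]
  rintro z -
  induction z with
  | zero => exact zero_mem _
  | add y z hy hz => exact add_mem hy hz
  | tmul u v => exact h1 u v

/-- `left_lTensor_T₁` exhibits q ⊗ π(aφ)x in the range of left multiplication by V, and
`right_lTensor_T₄` exhibits q ⊗ xπ(aφ) in the range of right multiplication. -/
theorem surjective_of_nondegenerate {ψ : Module.Dual ℂ A} (hψ : Q.IsRightHaar ψ)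
    (hρ : ∀ a, ∃ b, (a, b) ∈ Q.modularPairs ψ) {V : Multiplier (A ⊗[ℂ] B)}
    (hV : Q.IsCorepresentation V) {π : Q.dual →ₙₐ[ℂ] Multiplier B} (hπ : Q.IsInducedHom V π)
    (h : IsNondegenerateHom π) : Function.Surjective (left V) ∧ Function.Surjective (right V) := by
  refine ⟨LinearMap.range_eq_top.1 (tmul_span_eq_top h.1 _ ?_),
    LinearMap.range_eq_top.1 (tmul_span_eq_top h.2 _ ?_)⟩
  · rintro q _ ⟨ω, x, rfl⟩
    obtain ⟨a, rfl⟩ := Q.toDual_surjective ω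
    rw [hπ.left_toDual]
    exact ⟨_, Q.left_lTensor_T₁ hV a q x⟩
  · rintro q _ ⟨ω, x, rfl⟩
    obtain ⟨a, rfl⟩ := Q.toDual_surjective ω
    obtain ⟨b, hb⟩ := hρ a
    rw [hπ.right_toDual Q hb]
    exact ⟨_, Q.right_lTensor_T₄ hψ hV b q x⟩

theorem span_eq_top_of_tmul {ω : Module.Dual ℂ A} (hω : ω ≠ 0) {F : A ⊗[ℂ] B →ₗ[ℂ] A ⊗[ℂ] B}
    (hF : Function.Surjective F) {S : Set B} (h : ∀ a x, sliceFst ω (F (a ⊗ₜ x)) ∈ S) :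
    Submodule.span ℂ S = ⊤ := by
  rw [eq_top_iff]
  rintro z -
  obtain ⟨w, rfl⟩ := sliceFst_surjective hω z
  obtain ⟨t, rfl⟩ := hF w
  induction t with
  | zero => simp
  | add y z hy hz => simpa only [map_add] using add_mem hy hz
  | tmul a x => exact Submodule.subset_span (h a x)

/-- Slicing V(A ⊗ B) by φ gives elements of π(Â)B, and slicing (A ⊗ B)V by ψ gives elements of
Bπ(Â). The second part needs every b to occur in a modular pair. -/
theorem nondegenerate_of_surjective {ψ : Module.Dual ℂ A} (hψ : Q.IsRightHaar ψ)
    (hσ : ∀ b, ∃ a, (a, b) ∈ Q.modularPairs ψ) {V : Multiplier (A ⊗[ℂ] B)}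
    {π : Q.dual →ₙₐ[ℂ] Multiplier B} (hπ : Q.IsInducedHom V π)
    (hl : Function.Surjective (left V)) (hr : Function.Surjective (right V)) :
    IsNondegenerateHom π := by
  refine ⟨span_eq_top_of_tmul Q.φ_ne_zero hl fun a x => ⟨Q.toDual a, x, ?_⟩,
    span_eq_top_of_tmul hψ.ne_zero hr fun b x => ?_⟩
  · rw [hπ.left_toDual]
    rfl
  · obtain ⟨a, ha⟩ := hσ b
    refine ⟨Q.toDual a, x, ?_⟩
    rw [hπ.right_toDual Q ha]
    rfl

end InducedHom

/-! ### The dual algebra and existence of the universal corepresentation. -/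

/-- The dual algebra is non-degenerate. -/
instance dualNondegenerate : IsNondegenerate Q.dual where
  eq_zero_of_mul_right ω h := by
    have h1 : ∀ t : A ⊗[ℂ] A, (ω : Module.Dual ℂ A) (sliceSnd Q.φ (Q.T₂ t)) = 0 := fun t => by
      induction t with
      | zero => simp
      | add y z hy hz => simp only [map_add, hy, hz, add_zero]
      | tmul y a =>
        rw [← Q.dualSlice_eq (Q.toDual a) a y rfl, ← dual_mul_apply, h]
        rfl
    refine Subtype.ext (LinearMap.ext fun x => ?_)
    obtain ⟨t, rfl⟩ := ((sliceSnd_surjective Q.φ_ne_zero).comp Q.T₂.surjective) x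
    exact h1 t
  eq_zero_of_mul_left ω h := by
    have h1 : ∀ t : A ⊗[ℂ] A, Q.φ (sliceSnd (ω : Module.Dual ℂ A) (Q.T₁ t)) = 0 := fun t => by
      induction t with
      | zero => simp
      | add y z hy hz => simp only [map_add, hy, hz, add_zero]
      | tmul y a =>
        have h2 : Q.φ (Q.dualSlice ω y * a) = 0 := by
          have := congrArg (fun θ : Q.dual => (θ : Module.Dual ℂ A) y) (h (Q.toDual a))
          simpa [dual_mul_apply] using this
        rw [← Q.left_sndSlice, ← incl_dualSlice, left_incl, h2]
    obtain ⟨d, hd⟩ := exists_apply_eq_one Q.φ_ne_zero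
    refine Subtype.ext (LinearMap.ext fun x => ?_)
    -- Products (aφ)ω at y give (φ ⊙ ω)(Δ(y)(a ⊗ 1)); since `T₁` is onto, φ ⊙ ω vanishes at d ⊗ x,
    -- and φ(d) = 1 isolates ω(x).
    obtain ⟨t, ht⟩ := Q.T₁.surjective (d ⊗ₜ x)
    have := h1 t
    rw [ht] at this
    simpa [hd] using this

/-- The evaluation `ω ↦ ω(y)` on the dual. -/
def evalDual (y : A) : Module.Dual ℂ Q.dual := LinearMap.applyₗ y ∘ₗ Q.dual.subtype

theorem toOp_apply (z : A ⊗[ℂ] Q.dual) (y : A) : Q.toOp z y = sliceSnd (Q.evalDual y) z := by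
  induction z with
  | zero => simp
  | add y z hy hz => simp only [map_add, LinearMap.add_apply, hy, hz]
  | tmul u v => simp [evalDual]

/-- Evaluations at points of A separate Â, so identities in A ⊗ Â, in particular the defining
formulas of U, may be checked on operators. -/
theorem toOp_injective : Function.Injective Q.toOp := fun z w h => by
  refine eq_of_lTensor Q.evalDual (fun ω hω => Subtype.ext (LinearMap.ext hω)) fun y => ?_
  apply (TensorProduct.rid ℂ A).injective
  have := LinearMap.congr_fun h y
  rwa [toOp_apply, toOp_apply] at this

/-- The map `a ↦ a φ`. -/
def toDualₗ : A →ₗ[ℂ] Q.dual := (act.flip Q.φ).rangeRestrict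

theorem toDualₗ_apply (a : A) : Q.toDualₗ a = Q.toDual a := rfl

/-- Left multiplication by the universal corepresentation. -/
noncomputable def universalLeft : A ⊗[ℂ] Q.dual →ₗ[ℂ] A ⊗[ℂ] Q.dual :=
  LinearMap.lTensor A Q.toDualₗ ∘ₗ (TensorProduct.comm ℂ A A).toLinearMap ∘ₗ
    Q.T₁.symm.toLinearMap ∘ₗ LinearMap.lTensor A Q.rep

theorem toOp_lTensor_toDualₗ (t : A ⊗[ℂ] A) (y : A) :
    Q.toOp (LinearMap.lTensor A Q.toDualₗ (TensorProduct.comm ℂ A A t)) y =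
      sliceSnd Q.φ (left (Q.Δ y) (Q.T₁ t)) := by
  induction t with
  | zero => simp
  | add y z hy hz => simp only [map_add, LinearMap.add_apply, hy, hz]
  | tmul p q =>
    have : left (Q.Δ y) (Q.T₁ (p ⊗ₜ q)) = Q.T₁ ((y * p) ⊗ₜ q) := Q.coveringMaps.D_P₁ y q p
    simp [this, sliceSnd_φ_T₁, toDualₗ_apply]

/-- For ω = aφ and `T₁`⁻¹(x ⊗ a) = Σ p ⊗ q, the operator Σ q ⊗ pφ at y is Σ φ(yp)q, which by left
invariance is (ι ⊙ φ)(Δ(y)(x ⊗ a)). -/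
theorem toOp_universalLeft (x y : A) (ω : Q.dual) :
    Q.toOp (Q.universalLeft (x ⊗ₜ ω)) y = sliceSnd (ω : Module.Dual ℂ A) (Q.T₁ (y ⊗ₜ x)) := by
  change Q.toOp (LinearMap.lTensor A Q.toDualₗ (TensorProduct.comm ℂ A A
    (Q.T₁.symm (x ⊗ₜ Q.rep ω)))) y = _
  rw [toOp_lTensor_toDualₗ, LinearEquiv.apply_symm_apply, ← right_T₁, ← sliceSnd_act, act_rep]

section Right

variable {Q} {ψ : Module.Dual ℂ A} (hψ : Q.IsRightHaar ψ)
  (hσ : ∀ b, ∃ a, (a, b) ∈ Q.modularPairs ψ) (ρ : A →ₗ[ℂ] A)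
  (hρ : ∀ a, (a, ρ a) ∈ Q.modularPairs ψ)

/-- The map which sends `b` to the functional `x ↦ ψ(b x)`, an element of the dual. -/
def rightDual : A →ₗ[ℂ] Q.dual :=
  LinearMap.codRestrict Q.dual ((LinearMap.mul ℂ A).compr₂ ψ) fun b => by
    obtain ⟨a, ha⟩ := hσ b
    exact ⟨a, LinearMap.ext fun x => Q.mul_eq_of_mem_modularPairs ha x⟩

theorem rightDual_apply (b x : A) : (rightDual hσ b : Module.Dual ℂ A) x = ψ (b * x) := rfl

/-- Right multiplication by the universal corepresentation. -/
noncomputable def universalRight : A ⊗[ℂ] Q.dual →ₗ[ℂ] A ⊗[ℂ] Q.dual :=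
  LinearMap.lTensor A (rightDual hσ) ∘ₗ (TensorProduct.comm ℂ A A).toLinearMap ∘ₗ
    Q.T₄.symm.toLinearMap ∘ₗ (TensorProduct.comm ℂ A A).toLinearMap ∘ₗ
      LinearMap.lTensor A (ρ ∘ₗ Q.rep)

include hρ in
theorem apply_eq_of_rep (ω : Q.dual) (x : A) :
    (ω : Module.Dual ℂ A) x = ψ (ρ (Q.rep ω) * x) := by
  rw [← Q.mul_eq_of_mem_modularPairs (hρ _), ← act_apply, act_rep]

-- The mirror computation: ω is written as ψ(b ·), and right invariance of ψ evaluates (ψ ⊙ ι)((b ⊗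
-- x)Δ(y)).
include hρ hψ in
theorem toOp_universalRight (x y : A) (ω : Q.dual) : Q.toOp (universalRight hσ ρ (x ⊗ₜ ω)) y =
    sliceFst (ω : Module.Dual ℂ A) (Q.T₄ (y ⊗ₜ x)) := by
  have h1 : ∀ t : A ⊗[ℂ] A,
      Q.toOp (LinearMap.lTensor A (rightDual hσ) (TensorProduct.comm ℂ A A t)) y =
      sliceFst ψ (right (Q.Δ y) (Q.T₄ t)) := fun t => by
    induction t with
    | zero => simp
    | add y z hy hz => simp only [map_add, LinearMap.add_apply, hy, hz]
    | tmul p q =>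
      have : right (Q.Δ y) (Q.T₄ (p ⊗ₜ q)) = Q.T₄ ((p * y) ⊗ₜ q) := by
        apply incl_injective
        rw [incl_right, Q.T₄_spec, Q.T₄_spec, map_mul, mul_assoc]
      simp [this, hψ.T₄, rightDual_apply]
  have h0 : ∀ d : A, right (Q.Δ y) (d ⊗ₜ x) =
      LinearMap.rTensor A (LinearMap.mulLeft ℂ d) (Q.T₄ (y ⊗ₜ x)) := fun d => by
    apply incl_injective
    rw [← left_tensor_incl_one, incl_left, incl_right, Q.T₄_spec, ← mul_assoc]
    congr 1
    refine Multiplier.ext ?_ ?_ <;> ext p q <;> simp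
  have h2 : (ω : Module.Dual ℂ A) = ψ ∘ₗ LinearMap.mulLeft ℂ (ρ (Q.rep ω)) :=
    LinearMap.ext fun x => apply_eq_of_rep ρ hρ ω x
  change Q.toOp (LinearMap.lTensor A (rightDual hσ) (TensorProduct.comm ℂ A A
    (Q.T₄.symm (ρ (Q.rep ω) ⊗ₜ x)))) y = _
  rw [h1, LinearEquiv.apply_symm_apply, h0, sliceFst_rTensor, ← h2]

-- The compatibility making the two multiplications one multiplier. For s = a ⊗ ω with ω = ψ(b ·)
-- and t = a' ⊗ ω', both sides, as operators at y, equal a · (ψ ⊙ ι)((b ⊗ 1)Δ(y)) with the second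
-- leg v replaced by ((ι ⊙ ω')Δ(v))a'.
include hρ hψ in
theorem universal_mul_eq (s t : A ⊗[ℂ] Q.dual) :
    s * Q.universalLeft t = universalRight hσ ρ s * t := by
  induction s with
  | zero => simp
  | add y z hy hz => simp only [map_add, add_mul, hy, hz]
  | tmul a ω =>
    induction t with
    | zero => simp
    | add y z hy hz => simp only [map_add, mul_add, hy, hz]
    | tmul a' ω' =>
      apply Q.toOp_injective
      ext y
      have h1 : ∀ w : A ⊗[ℂ] Q.dual, Q.toOp (a ⊗ₜ ω * w) y =
          a * sliceFst ψ (LinearMap.lTensor A (Q.toOp w) (Q.T₃ (y ⊗ₜ ρ (Q.rep ω)))) := fun w => by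
        induction w with
        | zero => simp
        | add y z hy hz =>
          simp only [map_add, mul_add, LinearMap.lTensor_add, LinearMap.add_apply, hy, hz]
        | tmul c ν =>
          have h2 : ψ (ρ (Q.rep ω) * Q.dualSlice ν y) =
              ψ (sliceSnd (ν : Module.Dual ℂ A) (Q.T₃ (y ⊗ₜ ρ (Q.rep ω)))) := by
            rw [← Q.right_sndSlice, ← incl_dualSlice, right_incl]
          rw [sliceFst_lTensor, Algebra.TensorProduct.tmul_mul_tmul, toOp_tmul, dual_mul_apply,
            apply_eq_of_rep ρ hρ, h2, ← apply_sliceFst, toOp_tmul, mul_smul_comm]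
      have h3 : ∀ w : A ⊗[ℂ] Q.dual, Q.toOp (w * a' ⊗ₜ ω') y =
          Q.toOp w (Q.dualSlice ω' y) * a' := fun w => by
        induction w with
        | zero => simp
        | add y z hy hz => simp only [map_add, add_mul, LinearMap.add_apply, hy, hz]
        | tmul c ν =>
          rw [Algebra.TensorProduct.tmul_mul_tmul, toOp_tmul, toOp_tmul, dual_mul_apply,
            smul_mul_assoc]
      -- Coassociativity: Δ((ι ⊙ ω')Δ(y)) is y₁ ⊗ (ι ⊙ ω')Δ(y₂), here with the first leg covered by
      -- b.
      have h4 : Q.T₃ (Q.dualSlice ω' y ⊗ₜ ρ (Q.rep ω)) =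
          LinearMap.lTensor A (Q.dualSlice ω') (Q.T₃ (y ⊗ₜ ρ (Q.rep ω))) := by
        have h := congrArg (fun z => sliceSnd Q.φ ((TensorProduct.assoc ℂ A A A).symm z))
          (Q.coassoc_T₃_T₂ (ρ (Q.rep ω)) y (Q.rep ω'))
        simp only [LinearEquiv.symm_apply_apply, sliceSnd_rTensor] at h
        refine h.trans ?_
        generalize Q.T₃ (y ⊗ₜ ρ (Q.rep ω)) = w
        induction w with
        | zero => simp
        | add y z hy hz => simp only [map_add, hy, hz]
        | tmul u v => simp [sliceSnd_assoc_symm, dualSlice]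
      -- The factor a moves out of `T₄` once a' covers the second leg on the right, and ω = ψ(b ·)
      -- moves b into `T₃`.
      have h5 : sliceFst (ω : Module.Dual ℂ A) (Q.T₄ (Q.dualSlice ω' y ⊗ₜ a)) * a' =
          a * sliceFst ψ (LinearMap.lTensor A (LinearMap.mulRight ℂ a')
            (Q.T₃ (Q.dualSlice ω' y ⊗ₜ ρ (Q.rep ω)))) := by
        have h2 : (ω : Module.Dual ℂ A) = ψ ∘ₗ LinearMap.mulLeft ℂ (ρ (Q.rep ω)) :=
          LinearMap.ext fun x => apply_eq_of_rep ρ hρ ω x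
        change LinearMap.mulRight ℂ a' _ = LinearMap.mulLeft ℂ a _
        rw [← sliceFst_lTensor, ← T₂_T₄, sliceFst_lTensor, T₃_T₂, sliceFst_rTensor, ← h2]
      rw [h1, h3, toOp_universalRight hψ hσ ρ hρ, h5, h4, ← LinearMap.lTensor_comp_apply]
      congr 4
      ext v
      rw [toOp_universalLeft, LinearMap.comp_apply, LinearMap.mulRight_apply, ← left_incl,
        incl_dualSlice, Q.left_sndSlice]

end Right

theorem exists_universalCorepresentation : ∃ U : Multiplier (A ⊗[ℂ] Q.dual),
    Q.IsUniversalCorepresentation U := by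
  obtain ⟨ψ, hψ, ⟨ρ, hρ⟩, hσ⟩ := Q.exists_right_haar_modularPairs
  exact ⟨mkOfMulEq Q.universalLeft (universalRight hσ ρ) (universal_mul_eq hψ hσ ρ hρ),
    fun x y ω => ⟨Q.toOp_universalLeft x y ω, toOp_universalRight hψ hσ ρ hρ x y ω⟩⟩

/-! ### Uniqueness of U and the identity (ι ⊙ π_V)(U) = V. -/

variable {Q}

theorem IsUniversalCorepresentation.left_eq {U : Multiplier (A ⊗[ℂ] Q.dual)}
    (hU : Q.IsUniversalCorepresentation U) : left U = Q.universalLeft := by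
  refine TensorProduct.ext' fun x ω => Q.toOp_injective (LinearMap.ext fun y => ?_)
  rw [(hU x y ω).1, toOp_universalLeft]

theorem IsUniversalCorepresentation.unique {U U' : Multiplier (A ⊗[ℂ] Q.dual)}
    (hU : Q.IsUniversalCorepresentation U) (hU' : Q.IsUniversalCorepresentation U') : U' = U :=
  Multiplier.ext_left (by rw [hU.left_eq, hU'.left_eq])

variable {B : Type*} [NonUnitalRing B] [Module ℂ B] [IsScalarTower ℂ B B] [SMulCommClass ℂ B B]
  [IsNondegenerate B]

/-- The elements a ⊗ π(ω)x span A ⊗ B. On them the extension gives (ι ⊙ π)(U(a ⊗ ω))(1 ⊗ x), and the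
formula for `universalLeft` makes this the right side of `left_lTensor_T₁`, hence V(a ⊗ π(ω)x). -/
theorem IsUniversalCorepresentation.extSnd_eq {U : Multiplier (A ⊗[ℂ] Q.dual)}
    (hU : Q.IsUniversalCorepresentation U) {V : Multiplier (A ⊗[ℂ] B)}
    (hV : Q.IsCorepresentation V) {π : Q.dual →ₙₐ[ℂ] Multiplier B} (hπ : Q.IsInducedHom V π)
    (h : IsNondegenerateHom π) : extSnd π h U = V := by
  refine Multiplier.ext_left ?_
  rw [← sub_eq_zero, ← LinearMap.ker_eq_top]
  refine tmul_span_eq_top h.1 _ ?_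
  rintro a _ ⟨ω, x, rfl⟩
  rw [LinearMap.mem_ker, LinearMap.sub_apply, sub_eq_zero, extSnd, left_transport,
    TensorProduct.comm_symm_tmul, left_extFst, left_transport, TensorProduct.comm_symm_tmul,
    hU.left_eq]
  have h1 : ∀ t : A ⊗[ℂ] A, TensorProduct.comm ℂ B A (homLeft π (TensorProduct.comm ℂ A Q.dual
      (LinearMap.lTensor A Q.toDualₗ (TensorProduct.comm ℂ A A t))) x) =
      left V (LinearMap.lTensor A (leftFst Q.φ V x) (Q.T₁ t)) := fun t => by
    induction t with
    | zero => simp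
    | add y z hy hz => simp only [map_add, LinearMap.add_apply, hy, hz]
    | tmul p q => simp [Q.left_lTensor_T₁ hV, toDualₗ_apply, hπ.left_toDual]
  -- This tensor turns the argument of V in `h1` into a ⊗ π(ω)x.
  have h2 := h1 (Q.T₁.symm (a ⊗ₜ Q.rep ω))
  rw [LinearEquiv.apply_symm_apply, LinearMap.lTensor_tmul, ← hπ.left_toDual, toDual_rep] at h2
  exact h2

end AlgebraicQuantumGroup

end AlgQG

/-! ### The proposition. -/

theorem mainTheorem5
    {A : Type*} [NonUnitalRing A] [Module ℂ A] [IsScalarTower ℂ A A] [SMulCommClass ℂ A A]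
    [AlgQG.IsNondegenerate A] (Q : AlgQG.AlgebraicQuantumGroup A)
    {B : Type*} [NonUnitalRing B] [Module ℂ B] [IsScalarTower ℂ B B] [SMulCommClass ℂ B B]
    [AlgQG.IsNondegenerate B] :
    ∃ U : AlgQG.Multiplier (A ⊗[ℂ] Q.dual),
      (Q.IsUniversalCorepresentation U ∧
        ∀ U' : AlgQG.Multiplier (A ⊗[ℂ] Q.dual), Q.IsUniversalCorepresentation U' → U' = U) ∧
      ∀ V : AlgQG.Multiplier (A ⊗[ℂ] B), Q.IsCorepresentation V →
        ∃ π : Q.dual →ₙₐ[ℂ] AlgQG.Multiplier B,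
          (Q.IsInducedHom V π ∧
            ∀ π' : Q.dual →ₙₐ[ℂ] AlgQG.Multiplier B, Q.IsInducedHom V π' → π' = π) ∧
          (IsUnit V ↔ AlgQG.IsNondegenerateHom π) ∧
          (AlgQG.IsNondegenerateHom π ↔
            Set.range (AlgQG.Multiplier.left V) = Set.univ ∧
            Set.range (AlgQG.Multiplier.right V) = Set.univ) ∧
          (IsUnit V → ∃ hπ : AlgQG.IsNondegenerateHom π, AlgQG.extSnd π hπ U = V) := by
  obtain ⟨U, hU⟩ := Q.exists_universalCorepresentation
  obtain ⟨ψ, hψ, ⟨ρ, hρ⟩, hσ⟩ := Q.exists_right_haar_modularPairs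
  refine ⟨U, ⟨hU, fun U' hU' => hU.unique hU'⟩, fun V hV => ?_⟩
  obtain ⟨π, hπ⟩ := Q.exists_isInducedHom hρ hV
  -- Surjectivity of both multiplications by V links non-degeneracy of π to invertibility of V.
  have h1 : AlgQG.IsNondegenerateHom π ↔ Function.Surjective (AlgQG.Multiplier.left V) ∧
      Function.Surjective (AlgQG.Multiplier.right V) :=
    ⟨Q.surjective_of_nondegenerate hψ (fun a => ⟨_, hρ a⟩) hV hπ,
      fun h => Q.nondegenerate_of_surjective hψ hσ hπ h.1 h.2⟩
  have h2 : IsUnit V ↔ AlgQG.IsNondegenerateHom π :=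
    (AlgQG.AlgebraicQuantumGroup.isUnit_iff_surjective V).trans h1.symm
  refine ⟨π, ⟨hπ, fun π' hπ' => hπ.unique Q hπ'⟩, h2, ?_, fun h => ⟨h2.1 h, ?_⟩⟩
  · rw [h1, Set.range_eq_univ, Set.range_eq_univ]
  · exact hU.extSnd_eq hV hπ (h2.1 h)
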